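/- For a finite-dimensional complex Lie algebra $\mathfrak g$ and $f\in\mathfrak g^*$, let $\mathfrak g_f=\{x\in\mathfrak g : f([x,y])=0 \text{ for all } y\in\mathfrak g\}$; the index of $\mathfrak g$ is $\chi[\mathfrak g]=\min_{f\in\mathfrak g^*}\dim\mathfrak g_f$, and $\mathfrak g$ is called a Frobenius Lie algebra if $\chi[\mathfrak g]=0$. For positive integers $m,a,b$ and $n=ma+b$, let $\mathfrak p(\underbrace{a,\ldots,a}_{m},b)\subseteq\mathfrak{gl}(n,\mathbb C)$ be the parabolic subalgebra of block upper triangular matrices with successive diagonal blocks of sizes $a,\ldots,a$ ($m$ times) and $b$, and let $\mathfrak p_s(a,\ldots,a,b)=\mathfrak p(a,\ldots,a,b)\cap\mathfrak{sl}(n,\mathbb C)$. For all positive integers $m,a,b$, one has $\chi[\mathfrak p(\underbrace{a,\ldots,a}_{m},b)]=1$ if and only if $\gcd(a,b)=1$ and one of the following conditions holds: (i) $m=1$; (ii) $a$ is even and $b$ is odd; (iii) $a$ is odd, $b$ is even and $m=2$. Moreover, $\mathfrak p_s(\underbrace{a,\ldots,a}_{m},b)$ is a Frobenius subalgebra of $\mathfrak{sl}(n,\mathbb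 C)$ if and only if $\gcd(a,b)=1$ and one of (i), (ii), (iii) holds. -/

import Mathlib

/- Matrices carry the commutator bracket. -/
attribute [local instance 100] LieRing.ofAssociativeRing

namespace BlockParabolic

section Index

variable {L : Type*} [LieRing L] [LieAlgebra ℂ L]

/-- The stabilizer `L_f = {x ∈ L | f ⁅x, y⁆ = 0 for all y ∈ L}` of a linear form `f` on `L`
for the coadjoint action. -/
def stabilizer (f : Module.Dual ℂ L) : Submodule ℂ L where
  carrier := {x | ∀ y : L, f ⁅x, y⁆ = 0}
  add_mem' := by
    intro x y hx hy z
    rw [add_lie, map_add, hx z, hy z, add_zero]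
  zero_mem' := by
    intro z
    rw [zero_lie, map_zero]
  smul_mem' := by
    intro c x hx z
    rw [smul_lie, map_smul, hx z, smul_zero]

variable (L) in
/-- The index of a finite-dimensional complex Lie algebra `L`: the minimum of `dim L_f` over all
linear forms `f` on `L` (the infimum is over a nonempty set of natural numbers, so it is
attained). -/
noncomputable def index : ℕ :=
  sInf (Set.range fun f : Module.Dual ℂ L => Module.finrank ℂ (stabilizer f))

variable (L) in
/-- A finite-dimensional complex Lie algebra is a Frobenius Lie algebra if its index is `0`. -/
def IsFrobenius : Prop := index L = 0

end Index

/-- The standard parabolic subalgebra `𝔭(c)` of `𝔤𝔩(n)` attached to a composition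
`c = (c₁, …, cₖ)` of `n`: the block upper triangular matrices for the division of `{1, …, n}` into
`k` consecutive intervals of lengths `c₁, …, cₖ`. -/
def parabolic {n : ℕ} (c : Composition n) : LieSubalgebra ℂ (Matrix (Fin n) (Fin n) ℂ) where
  carrier := {A | A.BlockTriangular c.index}
  add_mem' := fun hA hB => hA.add hB
  zero_mem' := Matrix.blockTriangular_zero
  smul_mem' := by
    intro r A hA i j hij
    rw [Matrix.smul_apply, hA hij, smul_zero]
  lie_mem' := by
    intro A B hA hB
    rw [Ring.lie_def]
    exact (hA.mul hB).sub (hB.mul hA)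

/-- `𝔭ₛ(c) = 𝔭(c) ∩ 𝔰𝔩(n)`. -/
def specialParabolic {n : ℕ} (c : Composition n) : LieSubalgebra ℂ (Matrix (Fin n) (Fin n) ℂ) :=
  parabolic c ⊓ LieAlgebra.SpecialLinear.sl (Fin n) ℂ

/-- The composition `(a, …, a, b)` of `m * a + b`, with `a` repeated `m` times. -/
def repeatComposition (m a b : ℕ) (ha : 0 < a) (hb : 0 < b) : Composition (m * a + b) where
  blocks := List.replicate m a ++ [b]
  blocks_pos := by
    intro i hi
    rcases List.mem_append.1 hi with h | h
    · rw [List.eq_of_mem_replicate h]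
      exact ha
    · rw [List.mem_singleton.1 h]
      exact hb
  blocks_sum := by simp

end BlockParabolic

namespace BlockParabolic

/-! Both equivalences reduce to one property, `HasScalarStabilizer`: some linear form on matrices
has only scalars as stabilizer in the parabolic. Scalars always stabilize and, in characteristic
zero, split off the trace-zero part, so the property means index 1 for 𝔭 and index 0 for 𝔭ₛ.

Sufficiency. The parabolic is a seaweed algebra with upper blocks (a, …, a, b) and one lower block.
Its meander graph joins positions exchanged by the reversal of a block. An odd block has a fixed
centre, so a connected meander with exactly two odd blocks is a single path. Two reduction moves
shrink such a seaweed to size 1, and run backwards they build a suitable form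
(`brick_of_connected`). Connectivity in the listed cases is arithmetic modulo ma
(`connected_replicate`).

Necessity. Let φ have scalar stabilizer in the block triangular algebra S, normalized by φ(1) = 0. A
dimension count gives h with φ([h, y]) = φ(y), and h can be shifted so that exp(2πih) = 1
(`exists_int_spectrum`). Then h has integral spectrum and ε = exp(πih) is an involution whose
conjugation negates φ. The form φ([x, y]) + τ(x)τ(y), with τ the trace, is nondegenerate. Taking
adjoints for it gives 2 tr(ad h) = dim S - 1 and tr(y ↦ εyε) = 1. Written in block traces, the first
forces the block sizes to have gcd 1 and the second allows at most two odd blocks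
(`HasScalarStabilizer.exists_int`). -/

open Matrix

/-! ### Bricks, and their extension by new basis vectors. -/

/-- A relation `r` on a finite type is a brick if some matrix `F` commutes, at the positions `(i, j)`
with `r j i`, only with the scalars among the matrices supported on `r`. -/
def Brick {ι : Type*} [Fintype ι] [DecidableEq ι] (r : ι → ι → Prop) : Prop :=
  ∃ F : Matrix ι ι ℂ, ∀ x : Matrix ι ι ℂ, (∀ i j, ¬ r i j → x i j = 0) →
    (∀ i j, r j i → (F * x) i j = (x * F) i j) → ∃ z : ℂ, x = z • (1 : Matrix ι ι ℂ)

theorem Brick.flip {ι : Type*} [Fintype ι] [DecidableEq ι] {r : ι → ι → Prop} (h : Brick r) :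
    Brick (fun i j => r j i) := by
  obtain ⟨F, hF⟩ := h
  refine ⟨Fᵀ, fun x hx hc => ?_⟩
  obtain ⟨z, hz⟩ := hF xᵀ (fun i j hij => hx j i hij) (fun i j hij => by
    have := hc j i hij
    rw [← transpose_apply (Fᵀ * x), ← transpose_apply (x * Fᵀ), transpose_mul, transpose_mul,
      transpose_transpose] at this
    exact this.symm)
  refine ⟨z, ?_⟩
  rw [← transpose_transpose x, hz, transpose_smul, transpose_one]

theorem Brick.congr {ι κ : Type*} [Fintype ι] [DecidableEq ι] [Fintype κ] [DecidableEq κ]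
    (e : ι ≃ κ) {r : ι → ι → Prop} {s : κ → κ → Prop} (hrs : ∀ i j, s (e i) (e j) ↔ r i j)
    (h : Brick r) : Brick s := by
  obtain ⟨F, hF⟩ := h
  refine ⟨F.submatrix e.symm e.symm, fun x hx hc => ?_⟩
  obtain ⟨z, hz⟩ := hF (x.submatrix e e) (fun i j hij => hx _ _ (by rwa [hrs])) (fun i j hij => by
    have h1 := hc (e i) (e j) (by rwa [hrs])
    have h2 : F.submatrix e.symm e.symm * x = (F * x.submatrix e e).submatrix e.symm e.symm := by
      rw [← submatrix_mul_equiv F (x.submatrix e e) e.symm e.symm e.symm]; simp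
    have h3 : x * F.submatrix e.symm e.symm = (x.submatrix e e * F).submatrix e.symm e.symm := by
      rw [← submatrix_mul_equiv (x.submatrix e e) F e.symm e.symm e.symm]; simp
    rw [h2, h3] at h1
    simpa using h1)
  refine ⟨z, ?_⟩
  have : x = (x.submatrix e e).submatrix e.symm e.symm := by simp
  rw [this, hz]
  ext i j
  simp [Matrix.one_apply]

/-- The matrix of an injection of bases. -/
def inclMatrix {A K : Type*} [DecidableEq K] (e : A → K) : Matrix K A ℂ :=
  Matrix.of fun k a => if k = e a then 1 else 0

theorem mul_inclMatrix {A K ι : Type*} [Fintype K] [DecidableEq K] (e : A → K) (M : Matrix ι K ℂ)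
    (i : ι) (a : A) : (M * inclMatrix e) i a = M i (e a) := by
  simp [Matrix.mul_apply, inclMatrix]

theorem inclMatrix_mul {A K ι : Type*} [Fintype A] [DecidableEq K] {e : A → K}
    (he : Function.Injective e) (M : Matrix A ι ℂ) (a : A) (j : ι) :
    (inclMatrix e * M) (e a) j = M a j := by
  classical
  simp [Matrix.mul_apply, inclMatrix, he.eq_iff]

theorem inclMatrix_mul_of_notMem {A K ι : Type*} [Fintype A] [DecidableEq K] {e : A → K}
    (M : Matrix A ι ℂ) {k : K} (hk : ∀ a, k ≠ e a) (j : ι) : (inclMatrix e * M) k j = 0 := by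
  simp [Matrix.mul_apply, inclMatrix, hk]

/-- Adding basis vectors indexed by `A`, linked to those of `K` by `e`, preserves bricks. -/
theorem Brick.inflate {A K : Type*} [Fintype A] [DecidableEq A] [Fintype K] [DecidableEq K]
    {r : A ⊕ K → A ⊕ K → Prop} {r' : K → K → Prop} {U : K → Prop} {e : A → K}
    (he : Function.Injective e) (heU : ∀ a, U (e a))
    (hAA : ∀ a a', r (.inl a) (.inl a')) (hKA : ∀ k a, ¬ r (.inr k) (.inl a))
    (hAK : ∀ a k, r (.inl a) (.inr k) ↔ U k)
    (h1 : ∀ k k', r' k k' → r (.inr k) (.inr k'))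
    (h2 : ∀ k k', r (.inr k) (.inr k') → r' k k' ∨ (U k ∧ (∀ a, k ≠ e a) ∧ ∃ a, k' = e a))
    (h3 : ∀ j a, r' j (e a) → U j → ∃ a', j = e a')
    (h4 : ∀ j a, U j → (∀ a', j ≠ e a') → r (.inr j) (.inr (e a)))
    (h : Brick r') : Brick r := by
  obtain ⟨F, hF⟩ := h
  -- The new form only adds the links `a ↦ e a` to `F`, so commuting with it copies `P` into the
  -- columns `e a` of `X`.
  refine ⟨fromBlocks 0 0 (inclMatrix e) F, fun x hx hc => ?_⟩
  obtain ⟨P, Q, R, X, rfl⟩ : ∃ P Q R X, x = fromBlocks P Q R X :=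
    ⟨_, _, _, _, (fromBlocks_toBlocks x).symm⟩
  obtain rfl : R = 0 := by
    ext k a
    exact hx (.inr k) (.inl a) (hKA k a)
  have hQ : ∀ a k, ¬ U k → Q a k = 0 := fun a k hk => hx (.inl a) (.inr k) (by rwa [hAK])
  have hX : ∀ k k', ¬ r (.inr k) (.inr k') → X k k' = 0 := fun k k' => hx (.inr k) (.inr k')
  rw [fromBlocks_multiply, fromBlocks_multiply] at hc
  have c1 : ∀ a a', Q a (e a') = 0 := fun a a' => by
    have := hc (.inl a) (.inl a') (hAA _ _)
    simpa [mul_inclMatrix] using this.symm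
  have c2 : ∀ k a, U k → (inclMatrix e * P) k a = X k (e a) := fun k a hk => by
    have := hc (.inr k) (.inl a) (by rwa [hAK])
    simpa [mul_inclMatrix] using this
  have c3 : ∀ i j, r (.inr j) (.inr i) →
      (inclMatrix e * Q) i j + (F * X) i j = (X * F) i j := fun i j hij => by
    have := hc (.inr i) (.inr j) hij
    simpa using this
  -- The positions allowed by `r` but not by `r'` are killed by the links: there `X` equals a row of
  -- `inclMatrix e * P` outside the image of `e`.
  have hX' : ∀ i j, ¬ r' i j → X i j = 0 := fun i j hij => by
    by_cases hr : r (.inr i) (.inr j)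
    · obtain hr | ⟨hU, hi, a, rfl⟩ := h2 i j hr
      · exact absurd hr hij
      · rw [← c2 i a hU, inclMatrix_mul_of_notMem P hi]
    · exact hX i j hr
  obtain ⟨z, rfl⟩ := hF X hX' (fun i j hij => by
    rw [← c3 i j (h1 _ _ hij), right_eq_add]
    by_cases hi : ∃ a, i = e a
    · obtain ⟨a, rfl⟩ := hi
      rw [inclMatrix_mul he]
      by_cases hj : U j
      · obtain ⟨a', rfl⟩ := h3 j a hij hj
        exact c1 a a'
      · exact hQ a j hj
    · push Not at hi
      rw [inclMatrix_mul_of_notMem Q hi])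
  have hP : P = z • 1 := by
    ext a a'
    have := c2 (e a) a' (heU a)
    rw [inclMatrix_mul he] at this
    rw [this]
    simp [Matrix.one_apply, he.eq_iff]
  have hQ0 : Q = 0 := by
    ext a j
    by_cases hj : U j
    · by_cases hj' : ∃ a', j = e a'
      · obtain ⟨a', rfl⟩ := hj'
        exact c1 a a'
      · push Not at hj'
        have := c3 (e a) j (h4 j a hj hj')
        rw [inclMatrix_mul he] at this
        simpa using this
    · exact hQ a j hj
  refine ⟨z, ?_⟩
  rw [hP, hQ0, ← fromBlocks_one, fromBlocks_smul, smul_zero, smul_zero]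

/-- Adding basis vectors indexed by `D`, linked to the vectors of `K` in `U` but not in `N`,
preserves bricks. -/
theorem Brick.rotate {D K : Type*} [Fintype D] [DecidableEq D] [Fintype K] [DecidableEq K]
    {r : D ⊕ K → D ⊕ K → Prop} {r' : K → K → Prop} {N U : K → Prop} {e : D → K}
    (he : Function.Injective e) (heU : ∀ k, (∃ d, k = e d) ↔ U k ∧ ¬ N k)
    (hNU : ∀ k, N k → U k)
    (hDD : ∀ d d', r (.inl d) (.inl d')) (hDK : ∀ d k, r (.inl d) (.inr k) ↔ U k)
    (hKD : ∀ k d, r (.inr k) (.inl d) ↔ N k)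
    (hr : ∀ k k', r (.inr k) (.inr k') ↔ r' k k')
    (hN : ∀ k k', N k → (r' k k' ↔ U k')) (hN' : ∀ k k', N k' → (r' k k' ↔ N k))
    (hE : ∀ d k, r' (e d) k → U k)
    (h : Brick r') : Brick r := by
  classical
  obtain ⟨F, hF⟩ := h
  have eU : ∀ d, U (e d) := fun d => ((heU _).1 ⟨d, rfl⟩).1
  have eN : ∀ d, ¬ N (e d) := fun d => ((heU _).1 ⟨d, rfl⟩).2
  let E : K → Prop := fun k => U k ∧ ¬ N k
  -- The entries of `F` with row in `E` and column in `N` are moved to the rows of `D` by means of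
  -- `e`; `H` is what remains.
  let G : Matrix D K ℂ := Matrix.of fun d k => if N k then F (e d) k else 0
  let H : Matrix K K ℂ := Matrix.of fun k k' => if E k ∧ N k' then 0 else F k k'
  refine ⟨fromBlocks 0 G (inclMatrix e) H, fun x hx hc => ?_⟩
  obtain ⟨P, Q, R, X, rfl⟩ : ∃ P Q R X, x = fromBlocks P Q R X :=
    ⟨_, _, _, _, (fromBlocks_toBlocks x).symm⟩
  have hQ : ∀ d k, ¬ U k → Q d k = 0 := fun d k hk => hx (.inl d) (.inr k) (by rwa [hDK])
  have hR : ∀ k d, ¬ N k → R k d = 0 := fun k d hk => hx (.inr k) (.inl d) (by rwa [hKD])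
  have hX : ∀ k k', ¬ r' k k' → X k k' = 0 := fun k k' hk => hx (.inr k) (.inr k') (by rwa [hr])
  rw [fromBlocks_multiply, fromBlocks_multiply] at hc
  have c1 : ∀ d d', (G * R) d d' = Q d (e d') := fun a a' => by
    have := hc (.inl a) (.inl a') (hDD _ _)
    simpa [mul_inclMatrix] using this
  have c2 : ∀ d k, N k → (G * X) d k = (P * G) d k + (Q * H) d k := fun d k hk => by
    have := hc (.inl d) (.inr k) (by rwa [hKD])
    simpa using this
  have c3 : ∀ k d, U k → (inclMatrix e * P) k d + (H * R) k d = X k (e d) := fun k a hk => by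
    have := hc (.inr k) (.inl a) (by rwa [hDK])
    simpa [mul_inclMatrix] using this
  have c4 : ∀ i j, r' j i →
      (inclMatrix e * Q) i j + (H * X) i j = (R * G) i j + (X * H) i j := fun i j hij => by
    have := hc (.inr i) (.inr j) (by rwa [hr])
    simpa using this
  have XN : ∀ k n, N n → ¬ N k → X k n = 0 := fun k n hn hk => hX k n (by rwa [hN' k n hn])
  have hHR : ∀ d d', (H * R) (e d) d' = 0 := fun d d' => by
    rw [Matrix.mul_apply]
    refine Finset.sum_eq_zero fun k _ => ?_
    by_cases hk : N k
    · simp [H, E, eU, eN, hk]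
    · rw [hR k d' hk, mul_zero]
  have hPX : ∀ d d', P d d' = X (e d) (e d') := fun d d' => by
    rw [← c3 _ _ (eU d), hHR, inclMatrix_mul he, add_zero]
  have hQN : ∀ d n, N n → Q d n = 0 := fun d n hn => by
    have h0 := c4 (e d) n ((hN _ _ hn).2 (eU d))
    rw [inclMatrix_mul he] at h0
    have h5 : (H * X) (e d) n = 0 := by
      rw [Matrix.mul_apply]
      refine Finset.sum_eq_zero fun k _ => ?_
      by_cases hk : N k
      · simp [H, E, eU, eN, hk]
      · rw [XN k n hn hk, mul_zero]
    have h6 : (R * G) (e d) n = 0 := by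
      rw [Matrix.mul_apply]
      exact Finset.sum_eq_zero fun k _ => by rw [hR _ _ (eN d), zero_mul]
    have h7 : (X * H) (e d) n = 0 := by
      rw [Matrix.mul_apply]
      refine Finset.sum_eq_zero fun k _ => ?_
      by_cases hk : N k
      · rw [XN _ _ hk (eN d), zero_mul]
      · by_cases hk' : U k
        · simp [H, E, hk, hk', hn]
        · rw [hX (e d) k (fun h => hk' (hE d k h)), zero_mul]
    rwa [h5, h6, h7, add_zero, add_zero] at h0
  -- the matrix commuting with `F`
  let Y : Matrix K K ℂ := Matrix.of fun k k' =>
    if N k ∧ E k' then (R * (inclMatrix e)ᵀ) k k' else X k k'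
  have hRJ : ∀ k d, (R * (inclMatrix e)ᵀ) k (e d) = R k d := fun k d => by
    rw [← transpose_apply (R * _), transpose_mul, transpose_transpose, inclMatrix_mul he,
      transpose_apply]
  have hEe : ∀ d, E (e d) := fun d => ⟨eU d, eN d⟩
  have Y1 : ∀ k d, N k → Y k (e d) = R k d := fun k d hk => by simp [Y, hk, hEe, hRJ]
  have Y2 : ∀ k k', ¬ N k → Y k k' = X k k' := fun k k' hk => by simp [Y, hk]
  have Y3 : ∀ k k', ¬ E k' → Y k k' = X k k' := fun k k' hk => by simp [Y, hk]
  have H1 : ∀ k k', ¬ E k → H k k' = F k k' := fun k k' hk => by simp [H, hk]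
  have H2 : ∀ k k', ¬ N k' → H k k' = F k k' := fun k k' hk => by simp [H, hk]
  have H3 : ∀ k k', E k → N k' → H k k' = 0 := fun k k' hk hk' => by simp [H, hk, hk']
  -- Replacing the `N × E` block of `X` by `R` compensates for the block moved from `F` to `G`. The
  -- commutation with `F` is checked according to whether `i` and `j` lie in `N`, in `E` or outside
  -- `U`.
  obtain ⟨z, hz⟩ := hF Y (fun i j hij => by
    by_cases hi : N i
    · have hj : ¬ E j := fun h => hij ((hN i j hi).2 h.1)
      rw [Y3 _ _ hj, hX _ _ hij]
    · rw [Y2 _ _ hi, hX _ _ hij]) (fun i j hij => by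
    by_cases hi : N i
    · have hj : N j := (hN' _ _ hi).1 hij
      have hjE : ¬ E j := fun h => h.2 hj
      have hiE : ¬ E i := fun h => h.2 hi
      have h0 := c4 i j hij
      rw [inclMatrix_mul_of_notMem (e := e) Q (fun d hd => eN d (hd ▸ hi)), zero_add] at h0
      have h5 : (F * Y) i j = (H * X) i j := by
        simp only [Matrix.mul_apply]
        exact Finset.sum_congr rfl fun k _ => by rw [Y3 _ _ hjE, H1 _ _ hiE]
      have h6 : (R * G) i j = ∑ k, if E k then Y i k * F k j else 0 := by
        rw [Matrix.mul_apply]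
        refine Fintype.sum_of_injective e he _ _ (fun k hk => if_neg fun h => hk ?_) fun d => ?_
        · obtain ⟨d, rfl⟩ := (heU k).2 h
          exact ⟨d, rfl⟩
        · simp [hEe, Y1 _ _ hi, G, hj]
      rw [h5, h0, h6, Matrix.mul_apply, Matrix.mul_apply, ← Finset.sum_add_distrib]
      refine Finset.sum_congr rfl fun k _ => ?_
      by_cases hk : E k
      · rw [if_pos hk, H3 _ _ hk hj, mul_zero, add_zero]
      · rw [if_neg hk, zero_add, Y3 _ _ hk, H1 _ _ hk]
    · by_cases hiU : U i
      · obtain ⟨d, rfl⟩ := (heU i).2 ⟨hiU, hi⟩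
        by_cases hj : N j
        · have hjE : ¬ E j := fun h => h.2 hj
          have h0 := c2 d j hj
          have h5 : (Q * H) d j = 0 := by
            rw [Matrix.mul_apply]
            refine Finset.sum_eq_zero fun k _ => ?_
            by_cases hk : N k
            · rw [hQN d k hk, zero_mul]
            · by_cases hk' : U k
              · rw [H3 _ _ ⟨hk', hk⟩ hj, mul_zero]
              · rw [hQ d k hk', zero_mul]
          have h6 : (F * Y) (e d) j = (G * X) d j := by
            simp only [Matrix.mul_apply]
            refine Finset.sum_congr rfl fun k _ => ?_
            rw [Y3 _ _ hjE]
            by_cases hk : N k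
            · simp [G, hk]
            · rw [XN k j hj hk, mul_zero, mul_zero]
          rw [h6, h0, h5, add_zero]
          simp only [Matrix.mul_apply]
          refine Fintype.sum_of_injective e he _ _ (fun k hk => ?_) fun d' => ?_
          · rw [Y2 _ _ hi]
            by_cases hk' : N k
            · rw [XN _ _ hk' hi, zero_mul]
            · rw [hX _ _ fun h => hk ?_, zero_mul]
              obtain ⟨d', rfl⟩ := (heU k).2 ⟨hE _ _ h, hk'⟩
              exact ⟨d', rfl⟩
          · rw [Y2 _ _ hi, ← hPX]
            simp [G, hj]
        · have h0 := c4 _ j hij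
          have h5 : (R * G) (e d) j = 0 := by
            rw [Matrix.mul_apply]
            exact Finset.sum_eq_zero fun k _ => by rw [hR _ _ hi, zero_mul]
          have h6 : (Y * F) (e d) j = (X * H) (e d) j := by
            simp only [Matrix.mul_apply]
            exact Finset.sum_congr rfl fun k _ => by rw [Y2 _ _ hi, H2 _ _ hj]
          rw [h6, ← zero_add ((X * H) _ _), ← h5, ← h0, inclMatrix_mul he]
          by_cases hjU : U j
          · obtain ⟨d', rfl⟩ := (heU j).2 ⟨hjU, hj⟩
            rw [← c1]
            simp only [Matrix.mul_apply]
            rw [← Finset.sum_add_distrib]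
            refine Finset.sum_congr rfl fun k _ => ?_
            by_cases hk : N k
            · rw [Y1 _ _ hk, H3 _ _ (hEe d) hk]
              simp [G, hk]
            · rw [Y2 _ _ hk, H2 _ _ hk]
              simp [G, hk]
          · rw [hQ d j hjU, zero_add]
            simp only [Matrix.mul_apply]
            refine Finset.sum_congr rfl fun k _ => ?_
            rw [Y3 _ _ fun h => hjU h.1]
            by_cases hk : N k
            · rw [hX k j (by rwa [hN k j hk]), mul_zero, mul_zero]
            · rw [H2 _ _ hk]
      · have hjN : ¬ N j := fun h => hiU ((hN _ _ h).1 hij)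
        have hjE : ¬ E j := fun h => by
          obtain ⟨d, rfl⟩ := (heU j).2 h
          exact hiU (hE _ _ hij)
        have hiE : ¬ E i := fun h => hiU h.1
        have h0 := c4 i j hij
        rw [inclMatrix_mul_of_notMem (e := e) Q (fun d hd => hiU (by rw [hd]; exact eU d)),
          zero_add] at h0
        have h5 : (R * G) i j = 0 := by
          rw [Matrix.mul_apply]
          exact Finset.sum_eq_zero fun k _ => by rw [hR _ _ hi, zero_mul]
        rw [h5, zero_add] at h0
        simp only [Matrix.mul_apply] at h0 ⊢
        rw [Finset.sum_congr rfl fun k _ => by rw [Y3 _ _ hjE, ← H1 _ _ hiE], h0]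
        exact Finset.sum_congr rfl fun k _ => by rw [Y2 _ _ hi, H2 _ _ hjN])
  have hR0 : R = 0 := by
    ext k d
    by_cases hk : N k
    · rw [← Y1 k d hk, hz]
      have : k ≠ e d := fun h => eN d (h ▸ hk)
      simp [this]
    · exact hR k d hk
  have hX0 : X = z • 1 := by
    ext i j
    by_cases hij : N i ∧ E j
    · obtain ⟨d, rfl⟩ := (heU j).2 hij.2
      have : i ≠ e d := fun h => eN d (h ▸ hij.1)
      rw [← c3 i d (hNU i hij.1), hR0, Matrix.mul_zero,
        inclMatrix_mul_of_notMem (e := e) P fun d' h => eN d' (h ▸ hij.1)]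
      simp [this]
    · rw [← hz]
      simp [Y, hij]
  have hP0 : P = z • 1 := by
    ext d d'
    rw [hPX, hX0]
    simp [Matrix.one_apply, he.eq_iff]
  have hQ0 : Q = 0 := by
    ext d k
    by_cases hk : N k
    · exact hQN d k hk
    · by_cases hk' : U k
      · obtain ⟨d', rfl⟩ := (heU k).2 ⟨hk', hk⟩
        rw [← c1, hR0, Matrix.mul_zero]
        rfl
      · exact hQ d k hk'
  refine ⟨z, ?_⟩
  rw [hP0, hQ0, hR0, hX0, ← fromBlocks_one, fromBlocks_smul, smul_zero, smul_zero]

/-! ### Seaweed positions and the two reduction moves. -/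

/-- The index of the block containing the position `x`, for consecutive blocks of the given sizes. -/
def blockIndex : List ℕ → ℕ → ℕ
  | [], _ => 0
  | c :: C, x => if x < c then 0 else blockIndex C (x - c) + 1

theorem blockIndex_mono (c : List ℕ) {x y : ℕ} (h : x ≤ y) : blockIndex c x ≤ blockIndex c y := by
  induction c generalizing x y with
  | nil => exact le_rfl
  | cons c C ih =>
    have := @ih (x - c) (y - c) (by omega)
    simp only [blockIndex]
    split_ifs <;> omega

theorem blockIndex_cons_add (c : ℕ) (C : List ℕ) (x : ℕ) :
    blockIndex (c :: C) (c + x) = blockIndex C x + 1 := by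
  simp [blockIndex]

theorem blockIndex_cons_of_lt {c : ℕ} (C : List ℕ) {x : ℕ} (h : x < c) :
    blockIndex (c :: C) x = 0 := by
  simp [blockIndex, h]

theorem blockIndex_cons_eq_zero_iff {c : ℕ} {C : List ℕ} {x : ℕ} :
    blockIndex (c :: C) x = 0 ↔ x < c := by
  simp [blockIndex]

/-- The positions of the seaweed matrices with upper blocks `c` and lower blocks `d`. -/
def SeaweedRel (c d : List ℕ) (n : ℕ) (i j : Fin n) : Prop :=
  blockIndex c i ≤ blockIndex c j ∧ blockIndex d j ≤ blockIndex d i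

theorem Brick.seaweedRel_swap {c d : List ℕ} {n : ℕ} (h : Brick (SeaweedRel c d n)) :
    Brick (SeaweedRel d c n) :=
  h.flip.congr (Equiv.refl _) fun _ _ => and_comm

theorem Brick.seaweedRel_zero_cons {c d : List ℕ} {n : ℕ} (h : Brick (SeaweedRel c d n)) :
    Brick (SeaweedRel (0 :: c) d n) :=
  h.congr (Equiv.refl _) fun _ _ => by simp [SeaweedRel, blockIndex]

/-- The new vectors are the first `c` positions, linked to the last `c` positions of the lower block
`d`. The middle of that block, of size `d - 2 * c`, is separated from its end when the first `c`
positions are removed. -/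
theorem Brick.seaweedRel_inflate {c d k : ℕ} {C D : List ℕ} (hcd : 2 * c ≤ d) (hk : d ≤ c + k)
    (h : Brick (SeaweedRel C ((d - 2 * c) :: c :: D) k)) :
    Brick (SeaweedRel (c :: C) (d :: D) (c + k)) := by
  have htop : ∀ x, blockIndex (c :: C) (c + x) = blockIndex C x + 1 := blockIndex_cons_add c C
  have htop0 : ∀ x < c, blockIndex (c :: C) x = 0 := fun x => blockIndex_cons_of_lt C
  have hbot0 : ∀ x < d, blockIndex (d :: D) x = 0 := fun x => blockIndex_cons_of_lt D
  have hbot : ∀ x, blockIndex ((d - 2 * c) :: c :: D) x =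
      if x < d - 2 * c then 0 else if x < d - c then 1 else blockIndex (d :: D) (c + x) + 1 := by
    intro x
    rcases lt_or_ge x (d - 2 * c) with h1 | h1
    · simp [blockIndex, h1]
    · rcases lt_or_ge x (d - c) with h2 | h2
      · simp [blockIndex, h1.not_gt, h2, show x - (d - 2 * c) < c by omega]
      · obtain ⟨y, rfl⟩ := Nat.exists_eq_add_of_le h2
        have h3 : c + (d - c + y) = d + y := by omega
        have h4 : d - c + y = (d - 2 * c) + (c + y) := by omega
        rw [if_neg h1.not_gt, if_neg h2.not_gt, h3, h4]
        simp [blockIndex_cons_add]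
  refine Brick.congr finSumFinEquiv (r := fun i j =>
    SeaweedRel (c :: C) (d :: D) (c + k) (finSumFinEquiv i) (finSumFinEquiv j))
    (fun _ _ => Iff.rfl) ?_
  refine Brick.inflate (U := fun x => c + x.1 < d)
    (e := fun x : Fin c => (⟨d - 2 * c + x, by omega⟩ : Fin k)) ?_ ?_ ?_ ?_ ?_ ?_ ?_ ?_ ?_ h
  · intro x y hxy
    simp only [Fin.mk.injEq] at hxy
    omega
  · intro x
    simp only
    omega
  · intro x y
    simp [SeaweedRel, htop0, hbot0, show (x : ℕ) < d by omega, show (y : ℕ) < d by omega]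
  · intro x y
    simp [SeaweedRel, htop, htop0]
  · intro x y
    simp [SeaweedRel, htop, htop0, hbot0, show (x : ℕ) < d by omega, blockIndex_cons_eq_zero_iff]
  · intro x y
    simp only [SeaweedRel, hbot, finSumFinEquiv_apply_right, Fin.val_natAdd, htop]
    rintro ⟨hx, hy⟩
    refine ⟨by omega, ?_⟩
    by_cases hx' : c + (y : ℕ) < d
    · rw [hbot0 _ hx']
      exact Nat.zero_le _
    · split_ifs at hy <;> omega
  · intro x y
    simp only [SeaweedRel, hbot, finSumFinEquiv_apply_right, Fin.val_natAdd, htop, Fin.ext_iff, Ne]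
    rintro ⟨hx, hy⟩
    by_cases hy' : c + (y : ℕ) < d
    · by_cases hx' : c + (x : ℕ) < d
      · by_cases hx2 : (x : ℕ) < d - 2 * c
        · by_cases hy2 : (y : ℕ) < d - 2 * c
          · left
            simp only [if_pos hy2]
            omega
          · right
            refine ⟨hx', fun a => by omega, ⟨y - (d - 2 * c), by omega⟩, ?_⟩
            simp only
            omega
        · left
          refine ⟨by omega, ?_⟩
          split_ifs <;> omega
      · left
        refine ⟨by omega, ?_⟩
        split_ifs <;> omega
    · left
      have : ¬ c + (x : ℕ) < d := fun h => by
        rw [hbot0 _ h, Nat.le_zero, blockIndex_cons_eq_zero_iff] at hy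
        exact hy' hy
      refine ⟨by omega, ?_⟩
      split_ifs <;> omega
  · intro x y
    simp only [SeaweedRel, hbot, Fin.ext_iff]
    rintro ⟨-, h⟩ hx
    rw [if_neg (show ¬ d - 2 * c + (y : ℕ) < d - 2 * c by omega),
      if_pos (show d - 2 * c + (y : ℕ) < d - c by omega)] at h
    have hx2 : ¬ (x : ℕ) < d - 2 * c := fun hx2 => by simp [hx2] at h
    exact ⟨⟨x - (d - 2 * c), by omega⟩, by simp only; omega⟩
  · intro x y hx hx'
    simp only [Fin.ext_iff, Ne] at hx'
    have hx2 : (x : ℕ) < d - 2 * c := by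
      by_contra hcon
      exact hx' ⟨x - (d - 2 * c), by omega⟩ (by simp only; omega)
    simp only [SeaweedRel, finSumFinEquiv_apply_right, Fin.val_natAdd, htop]
    refine ⟨Nat.succ_le_succ (blockIndex_mono _ (by omega)), ?_⟩
    rw [hbot0 _ (by omega), hbot0 _ (by omega)]

/-- The new vectors are the first `d - c` positions. `N` is the rest of the upper block `c`, `U` the
rest of the lower block `d`, and the smaller relation is the restriction to the remaining positions.
-/
theorem Brick.seaweedRel_rotate {c d k : ℕ} {C D : List ℕ} (hcd : c < d) (hdc : d < 2 * c)
    (hk : c ≤ k) (h : Brick (SeaweedRel ((2 * c - d) :: C) (c :: D) k)) :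
    Brick (SeaweedRel (c :: C) (d :: D) (d - c + k)) := by
  have htop0 : ∀ x < c, blockIndex (c :: C) x = 0 := fun x => blockIndex_cons_of_lt C
  have hbot0 : ∀ x < d, blockIndex (d :: D) x = 0 := fun x => blockIndex_cons_of_lt D
  have htop : ∀ x, blockIndex (c :: C) (d - c + x) = blockIndex ((2 * c - d) :: C) x := by
    intro x
    rcases lt_or_ge x (2 * c - d) with h1 | h1
    · rw [blockIndex_cons_of_lt _ h1, blockIndex_cons_of_lt _ (by omega)]
    · obtain ⟨y, rfl⟩ := Nat.exists_eq_add_of_le h1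
      rw [show d - c + (2 * c - d + y) = c + y by omega, blockIndex_cons_add, blockIndex_cons_add]
  have hbot : ∀ x, blockIndex (d :: D) (d - c + x) = blockIndex (c :: D) x := by
    intro x
    rcases lt_or_ge x c with h1 | h1
    · rw [blockIndex_cons_of_lt _ h1, blockIndex_cons_of_lt _ (by omega)]
    · obtain ⟨y, rfl⟩ := Nat.exists_eq_add_of_le h1
      rw [show d - c + (c + y) = d + y by omega, blockIndex_cons_add, blockIndex_cons_add]
  refine Brick.congr finSumFinEquiv (r := fun i j =>
    SeaweedRel (c :: C) (d :: D) (d - c + k) (finSumFinEquiv i) (finSumFinEquiv j))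
    (fun _ _ => Iff.rfl) ?_
  refine Brick.rotate (N := fun x => x.1 < 2 * c - d) (U := fun x => x.1 < c)
    (e := fun x : Fin (d - c) => (⟨2 * c - d + x, by omega⟩ : Fin k))
    ?_ ?_ ?_ ?_ ?_ ?_ ?_ ?_ ?_ ?_ h
  · intro x y hxy
    simp only [Fin.mk.injEq] at hxy
    omega
  · intro x
    simp only [Fin.ext_iff]
    constructor
    · rintro ⟨a, ha⟩
      omega
    · intro hx
      exact ⟨⟨x - (2 * c - d), by omega⟩, by simp only; omega⟩
  · intro x hx
    omega
  · intro x y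
    simp [SeaweedRel, htop0, hbot0, show (x : ℕ) < d by omega, show (y : ℕ) < d by omega,
      show (x : ℕ) < c by omega, show (y : ℕ) < c by omega]
  · intro x y
    simp [SeaweedRel, htop0, hbot0, hbot, show (x : ℕ) < d by omega, show (x : ℕ) < c by omega,
      blockIndex_cons_eq_zero_iff]
  · intro x y
    simp [SeaweedRel, htop0, hbot0, htop, show (y : ℕ) < d by omega, show (y : ℕ) < c by omega,
      blockIndex_cons_eq_zero_iff]
  · intro x y
    simp [SeaweedRel, htop, hbot]
  · intro x y hx
    have hx' : (x : ℕ) < c := by omega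
    simp [SeaweedRel, blockIndex_cons_of_lt _ hx, blockIndex_cons_of_lt _ hx',
      blockIndex_cons_eq_zero_iff]
  · intro x y hy
    have hy' : (y : ℕ) < c := by omega
    simp [SeaweedRel, blockIndex_cons_of_lt _ hy, blockIndex_cons_of_lt _ hy',
      blockIndex_cons_eq_zero_iff]
  · rintro x y ⟨-, hxy⟩
    have hx' : 2 * c - d + (x : ℕ) < c := by omega
    simpa [blockIndex_cons_of_lt _ hx', blockIndex_cons_eq_zero_iff] using hxy

/-! ### Meander connectivity under the reduction moves. -/

/-- Invariance under the reversal of each of the consecutive blocks of the given sizes. -/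
def ReflInvariant : List ℕ → (ℕ → Prop) → Prop
  | [], _ => True
  | c :: C, g => (∀ x < c, g (c - 1 - x) ↔ g x) ∧ ReflInvariant C (fun x => g (c + x))

/-- Only the constants on `{0, …, n - 1}` are invariant under the reversals of the blocks of `c`
and of `d`: the meander of `c` and `d` is connected. -/
def Connected (c d : List ℕ) (n : ℕ) : Prop :=
  ∀ g : ℕ → Prop, ReflInvariant c g → ReflInvariant d g → ∀ x < n, (g x ↔ g 0)

theorem Connected.symm {c d : List ℕ} {n : ℕ} (h : Connected c d n) : Connected d c n :=
  fun g hc hd => h g hd hc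

theorem reflInvariant_zero_cons {c : List ℕ} {g : ℕ → Prop} :
    ReflInvariant (0 :: c) g ↔ ReflInvariant c g := by
  simp [ReflInvariant]

/-- An invariant predicate on the smaller meander extends to a removed position by its value at the
mirror image in the lower block `d`; the extension is invariant, hence constant. -/
theorem Connected.deflate {c d k : ℕ} {C D : List ℕ} (hcd : 2 * c ≤ d)
    (hc : 0 < c) (h : Connected (c :: C) (d :: D) (c + k)) :
    Connected C ((d - 2 * c) :: c :: D) k := by
  rintro g hC ⟨h1, h2, hD⟩ x hx
  have hg := h (fun x => if x < c then g (d - 1 - x - c) else g (x - c)) ⟨fun x hx => ?_, ?_⟩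
    ⟨fun x hx => ?_, ?_⟩
  · have e1 := hg (c + x) (by omega)
    have e2 := hg c (by omega)
    simp only [add_lt_iff_neg_left, not_lt_zero, if_false, add_tsub_cancel_left, lt_irrefl,
      tsub_self] at e1 e2
    exact e1.trans e2.symm
  · have := h2 x hx
    simp only [if_pos hx, if_pos (show c - 1 - x < c by omega)]
    rw [show d - 1 - (c - 1 - x) - c = d - 2 * c + x by omega,
      show d - 1 - x - c = d - 2 * c + (c - 1 - x) by omega]
    exact this.symm
  · simpa using hC
  · by_cases hx1 : x < c
    · simp only [if_pos hx1, if_neg (show ¬ d - 1 - x < c by omega)]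
    · by_cases hx2 : d - 1 - x < c
      · simp only [if_neg hx1, if_pos hx2]
        rw [show d - 1 - (d - 1 - x) - c = x - c by omega]
      · simp only [if_neg hx1, if_neg hx2]
        have := h1 (x - c) (by omega)
        rwa [show d - 2 * c - 1 - (x - c) = d - 1 - x - c by omega] at this
  · convert hD using 2 with x
    simp only [if_neg (show ¬ d + x < c by omega)]
    rw [show d + x - c = d - 2 * c + (c + x) by omega]

/-- Same extension by the mirror image in the lower block `d`; a removed position `x` goes to `d - 1
- x`, which is `c - 1 - x` after renumbering. -/
theorem Connected.unrotate {c d k : ℕ} {C D : List ℕ} (hcd : c < d) (hdc : d < 2 * c)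
    (h : Connected (c :: C) (d :: D) (d - c + k)) :
    Connected ((2 * c - d) :: C) (c :: D) k := by
  rintro g ⟨h1, hC⟩ ⟨h2, hD⟩ x hx
  have hg := h (fun x => if x < d - c then g (c - 1 - x) else g (x - (d - c))) ⟨fun x hx => ?_, ?_⟩
    ⟨fun x hx => ?_, ?_⟩
  · have e1 := hg (d - c + x) (by omega)
    have e2 := hg (d - c) (by omega)
    simp only [add_lt_iff_neg_left, not_lt_zero, if_false, add_tsub_cancel_left, lt_irrefl,
      tsub_self] at e1 e2
    exact e1.trans e2.symm
  · by_cases hx1 : x < d - c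
    · by_cases hx2 : c - 1 - x < d - c
      · simp only [if_pos hx1, if_pos hx2]
        have := h2 x hx
        rw [show c - 1 - (c - 1 - x) = x by omega]
        exact this.symm
      · simp only [if_pos hx1, if_neg hx2]
        have e1 := h1 x (by omega)
        rw [show c - 1 - x - (d - c) = 2 * c - d - 1 - x by omega]
        exact e1.trans (h2 x hx).symm
    · by_cases hx2 : c - 1 - x < d - c
      · simp only [if_neg hx1, if_pos hx2]
        have e1 := h1 (x - (d - c)) (by omega)
        rw [show 2 * c - d - 1 - (x - (d - c)) = c - 1 - x by omega] at e1
        rw [show c - 1 - (c - 1 - x) = x by omega]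
        exact (h2 x hx).symm.trans e1
      · simp only [if_neg hx1, if_neg hx2]
        have e1 := h1 (x - (d - c)) (by omega)
        rw [show 2 * c - d - 1 - (x - (d - c)) = c - 1 - x by omega] at e1
        have e2 := h1 x (by omega)
        rw [show 2 * c - d - 1 - x = c - 1 - x - (d - c) by omega] at e2
        exact e2.trans ((h2 x hx).symm.trans e1)
  · convert hC using 2 with x
    simp only [if_neg (show ¬ c + x < d - c by omega)]
    rw [show c + x - (d - c) = 2 * c - d + x by omega]
  · by_cases hx1 : x < d - c
    · simp only [if_pos hx1, if_neg (show ¬ d - 1 - x < d - c by omega)]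
      rw [show d - 1 - x - (d - c) = c - 1 - x by omega]
    · by_cases hx2 : d - 1 - x < d - c
      · simp only [if_neg hx1, if_pos hx2]
        rw [show c - 1 - (d - 1 - x) = x - (d - c) by omega]
      · simp only [if_neg hx1, if_neg hx2]
        have e1 := h1 (x - (d - c)) (by omega)
        rwa [show 2 * c - d - 1 - (x - (d - c)) = d - 1 - x - (d - c) by omega] at e1
  · convert hD using 2 with x
    simp only [if_neg (show ¬ d + x < d - c by omega)]
    rw [show d + x - (d - c) = c + x by omega]

/-! ### From a meander that is a path to a brick. -/

/-- The number of odd parts. -/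
def oddParts (c : List ℕ) : ℕ := (c.map (· % 2)).sum

theorem oddParts_cons (c : ℕ) (C : List ℕ) : oddParts (c :: C) = c % 2 + oddParts C := by
  simp [oddParts]

theorem oddParts_eq_zero_of_sum_eq_zero {c : List ℕ} (h : c.sum = 0) : oddParts c = 0 := by
  rw [List.sum_eq_zero_iff] at h
  refine List.sum_eq_zero fun x hx => ?_
  obtain ⟨y, hy, rfl⟩ := List.mem_map.1 hx
  simp [h y hy]

theorem reflInvariant_of_forall {c : List ℕ} {g : ℕ → Prop} {p : Prop} (h : ∀ x, g x ↔ p) :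
    ReflInvariant c g := by
  induction c generalizing g with
  | nil => trivial
  | cons c C ih => exact ⟨fun x _ => (h _).trans (h _).symm, ih fun x => h _⟩

theorem brick_one (r : Fin 1 → Fin 1 → Prop) : Brick r :=
  ⟨0, fun x _ _ => ⟨x 0 0, by ext i j; fin_cases i; fin_cases j; simp⟩⟩

/-- The common first block is a union of components, so it is everything. Two odd parts then make
`c` odd, and the component `{0, c - 1}` can only be everything if `c = 1`. -/
theorem eq_one_of_connected_cons_cons {c n : ℕ} {C D : List ℕ} (hc : 0 < c)
    (hC : c + C.sum = n) (hD : c + D.sum = n) (h : Connected (c :: C) (c :: D) n)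
    (hodd : oddParts (c :: C) + oddParts (c :: D) = 2) : n = 1 := by
  have hn : n ≤ c := by
    by_contra hcon
    have := h (fun x => x < c)
      ⟨fun x hx => by omega, reflInvariant_of_forall (p := False) fun x => iff_of_false (by omega) id⟩
      ⟨fun x hx => by omega, reflInvariant_of_forall (p := False) fun x => iff_of_false (by omega) id⟩
      c (by omega)
    omega
  rw [oddParts_cons, oddParts_cons, oddParts_eq_zero_of_sum_eq_zero (by omega),
    oddParts_eq_zero_of_sum_eq_zero (by omega)] at hodd
  by_contra hcon
  have := h (fun x => x = 0 ∨ x = c - 1)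
    ⟨fun x hx => by omega, reflInvariant_of_forall (p := False) fun x => iff_of_false (by omega) id⟩
    ⟨fun x hx => by omega, reflInvariant_of_forall (p := False) fun x => iff_of_false (by omega) id⟩
    1 (by omega)
  omega

/-- Both reduction moves preserve connectivity and the number of odd parts, and they lower the size
plus the number of blocks. Connectivity alone would allow a cycle; the two odd parts supply the two
ends of a path. -/
theorem brick_of_connected : ∀ (N : ℕ) (c d : List ℕ) (n : ℕ), n + c.length + d.length ≤ N →
    c.sum = n → d.sum = n → 0 < n → Connected c d n → oddParts c + oddParts d = 2 →
    Brick (SeaweedRel c d n) := by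
  intro N
  induction N with
  | zero => intro c d n h1 h2 h3 h4; omega
  | succ N ih =>
    have key : ∀ (c d : ℕ) (C D : List ℕ) (n : ℕ),
        n + (c :: C).length + (d :: D).length ≤ N + 1 → c + C.sum = n → d + D.sum = n → 0 < c →
        c < d → Connected (c :: C) (d :: D) n → oddParts (c :: C) + oddParts (d :: D) = 2 →
        Brick (SeaweedRel (c :: C) (d :: D) n) := by
      intro c d C D n hN hC hD hc hcd h hodd
      simp only [List.length_cons] at hN
      rw [oddParts_cons, oddParts_cons] at hodd
      rcases le_or_gt (2 * c) d with h2 | h2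
      · obtain ⟨k, rfl⟩ := Nat.exists_eq_add_of_le (show c ≤ n by omega)
        refine Brick.seaweedRel_inflate h2 (by omega) (ih _ _ _ ?_ ?_ ?_ ?_ (h.deflate h2 hc) ?_)
        · simp only [List.length_cons]; omega
        · omega
        · simp only [List.sum_cons]; omega
        · omega
        · rw [oddParts_cons, oddParts_cons]; omega
      · obtain ⟨k, rfl⟩ := Nat.exists_eq_add_of_le (show d - c ≤ n by omega)
        refine Brick.seaweedRel_rotate hcd h2 (by omega)
          (ih _ _ _ ?_ ?_ ?_ ?_ (h.unrotate hcd h2) ?_)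
        · simp only [List.length_cons]; omega
        · simp only [List.sum_cons]; omega
        · simp only [List.sum_cons]; omega
        · omega
        · rw [oddParts_cons, oddParts_cons]; omega
    intro c d n hN hc hd hn h hodd
    match c, d with
    | [], _ => simp at hc; omega
    | _, [] => simp at hd; omega
    | 0 :: C, d =>
      refine Brick.seaweedRel_zero_cons (ih C d n ?_ ?_ hd hn ?_ ?_)
      · simp only [List.length_cons] at hN; omega
      · simpa using hc
      · exact fun g hg => h g (reflInvariant_zero_cons.2 hg)
      · simpa [oddParts_cons] using hodd
    | c, 0 :: D =>
      refine (Brick.seaweedRel_zero_cons (ih D c n ?_ ?_ hc hn ?_ ?_)).seaweedRel_swap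
      · simp only [List.length_cons] at hN; omega
      · simpa using hd
      · exact fun g hg => h.symm g (reflInvariant_zero_cons.2 hg)
      · rw [oddParts_cons] at hodd; omega
    | (c + 1) :: C, (d + 1) :: D =>
      simp only [List.sum_cons] at hc hd
      rcases lt_trichotomy (c + 1) (d + 1) with hcd | hcd | hcd
      · exact key _ _ _ _ _ hN hc hd (by omega) hcd h hodd
      · rw [hcd] at h hodd hc
        obtain rfl := eq_one_of_connected_cons_cons (by omega) hc hd h hodd
        exact brick_one _
      · exact (key _ _ _ _ _ (by omega) hd hc (by omega) hcd h.symm (by omega)).seaweedRel_swap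

/-! ### Connectivity of the meander of (a, …, a, b) over one block. -/

theorem ReflInvariant.replicate_append {m a b : ℕ} {g : ℕ → Prop}
    (h : ReflInvariant (List.replicate m a ++ [b]) g) :
    (∀ i < m, ∀ r < a, (g (i * a + (a - 1 - r)) ↔ g (i * a + r))) ∧
      ∀ y < b, (g (m * a + (b - 1 - y)) ↔ g (m * a + y)) := by
  induction m generalizing g with
  | zero => exact ⟨by simp, by simpa [ReflInvariant] using h⟩
  | succ m ih =>
    rw [List.replicate_succ, List.cons_append] at h
    obtain ⟨h0, h1⟩ := h
    obtain ⟨h2, h3⟩ := ih h1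
    refine ⟨fun i hi r hr => ?_, fun y hy => ?_⟩
    · rcases i with - | i
      · simpa using h0 r hr
      · have := h2 i (by omega) r hr
        rwa [← add_assoc, ← add_assoc, show a + i * a = (i + 1) * a by ring] at this
    · have := h3 y hy
      rwa [← add_assoc, ← add_assoc, show a + m * a = (m + 1) * a by ring] at this

theorem iff_zero_of_isCoprime {G : ℤ → Prop} {N t : ℤ} (hper : ∀ x y, N ∣ x - y → (G x ↔ G y))
    (hG : ∀ z, G z ↔ G (z + t)) (h : IsCoprime t N) (z : ℤ) : G z ↔ G 0 := by
  have hk : ∀ (k z : ℤ), G z ↔ G (z + k * t) := by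
    intro k
    induction k with
    | zero => simp
    | succ k ih =>
      intro z
      rw [ih z, hG, show z + k * t + t = z + (k + 1) * t by ring]
    | pred k ih =>
      intro z
      rw [ih z, hG (z + (-k - 1) * t), show z + (-k - 1) * t + t = z + -k * t by ring]
  obtain ⟨u, v, huv⟩ := h
  rw [hk (z * u) 0]
  exact hper _ _ ⟨z * v, by linear_combination (-z) * huv⟩

/-- Moving the summation window by one step, with `a` even, shows that the sums satisfy S(b + 1) =
-S(b) - 1. -/
theorem sum_neg_one_pow_mul_div {a : ℕ} (ha : Even a) (ha0 : 0 < a) (b : ℕ) :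
    ∑ ρ ∈ Finset.range a, (-1 : ℤ) ^ ρ * (((ρ + b) / a : ℕ) : ℤ) = -((b % 2 : ℕ) : ℤ) := by
  induction b with
  | zero =>
    refine Finset.sum_eq_zero fun ρ hρ => ?_
    simp [Nat.div_eq_of_lt (Finset.mem_range.1 hρ)]
  | succ b ih =>
    have h1 := Finset.sum_range_succ (fun ρ => (-1 : ℤ) ^ ρ * (((ρ + b) / a : ℕ) : ℤ)) a
    rw [Finset.sum_range_succ', ih, ha.neg_one_pow, Nat.add_div_left _ ha0] at h1
    have h2 : ∑ ρ ∈ Finset.range a, (-1 : ℤ) ^ (ρ + 1) * (((ρ + 1 + b) / a : ℕ) : ℤ) =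
        -∑ ρ ∈ Finset.range a, (-1 : ℤ) ^ ρ * (((ρ + (b + 1)) / a : ℕ) : ℤ) := by
      rw [← Finset.sum_neg_distrib]
      refine Finset.sum_congr rfl fun ρ _ => ?_
      rw [show ρ + 1 + b = ρ + (b + 1) by ring]
      ring
    rw [h2] at h1
    generalize ∑ ρ ∈ Finset.range a, (-1 : ℤ) ^ ρ * (((ρ + (b + 1)) / a : ℕ) : ℤ) = X at h1 ⊢
    rw [pow_zero, one_mul, one_mul, zero_add, Nat.cast_succ] at h1
    omega

theorem image_mul_mod_range {a b : ℕ} (ha : 0 < a) (h : Nat.Coprime a b) :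
    (Finset.range a).image (fun j => j * b % a) = Finset.range a ∧
      Set.InjOn (fun j => j * b % a) (Finset.range a : Set ℕ) := by
  have hinj : Set.InjOn (fun j => j * b % a) (Finset.range a : Set ℕ) := by
    intro i hi j hj hij
    have h1 : i ≡ j [MOD a] := Nat.ModEq.cancel_right_of_coprime h hij
    rw [Finset.coe_range, Set.mem_Iio] at hi hj
    exact Nat.ModEq.eq_of_lt_of_lt h1 hi hj
  refine ⟨Finset.eq_of_subset_of_card_le ?_ (Finset.card_image_of_injOn hinj).ge, hinj⟩
  intro x hx
  obtain ⟨j, -, rfl⟩ := Finset.mem_image.1 hx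
  exact Finset.mem_range.2 (Nat.mod_lt _ ha)

/-- The block indices met along the meander, starting in block `0`. -/
def orbitBlock (a b : ℕ) : ℕ → ℤ
  | 0 => 0
  | k + 1 => -orbitBlock a b k - 1 + ((k * b % a + b) / a : ℕ)

/-- The recursion unfolds to an alternating sum over `j < a`. Since `a` is even and `b` odd, `j` and
`j * b % a` have the same parity, and coprimality lets the residue replace `j` as summation index.
-/
theorem orbitBlock_self {a b : ℕ} (ha : Even a) (ha0 : 0 < a) (hb : Odd b) (h : Nat.Coprime a b) :
    orbitBlock a b a = 1 := by
  have h1 : ∀ k, (-1) ^ k * orbitBlock a b k =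
      ∑ j ∈ Finset.range k, ((-1) ^ j - (-1) ^ j * (((j * b % a + b) / a : ℕ) : ℤ)) := by
    intro k
    induction k with
    | zero => simp [orbitBlock]
    | succ k ih =>
      rw [Finset.sum_range_succ, ← ih, orbitBlock]
      ring
  have h2 := h1 a
  have h3 : ∀ j, (-1 : ℤ) ^ j = (-1) ^ (j * b % a) := by
    intro j
    rw [neg_one_pow_eq_pow_mod_two, neg_one_pow_eq_pow_mod_two (n := j * b % a),
      Nat.mod_mod_of_dvd _ ha.two_dvd, Nat.mul_mod, Nat.odd_iff.1 hb, mul_one, Nat.mod_mod]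
  have h4 : ∀ j, (-1 : ℤ) ^ j * (((j * b % a + b) / a : ℕ) : ℤ) =
      (-1) ^ (j * b % a) * (((j * b % a + b) / a : ℕ) : ℤ) := fun j => by rw [← h3]
  rw [ha.neg_one_pow, one_mul, Finset.sum_sub_distrib, neg_one_geom_sum, if_pos ha,
    Finset.sum_congr rfl (fun j _ => h4 j),
    ← Finset.sum_image (f := fun ρ => (-1) ^ ρ * (((ρ + b) / a : ℕ) : ℤ))
      (image_mul_mod_range ha0 h).2, (image_mul_mod_range ha0 h).1,
    sum_neg_one_pow_mul_div ha ha0, Nat.odd_iff.1 hb] at h2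
  rw [h2]
  rfl

theorem iff_zero_of_even_of_odd {a b : ℕ} {G : ℤ → Prop} (ha : Even a) (ha0 : 0 < a) (hb : Odd b)
    (h : Nat.Coprime a b)
    (hG : ∀ i r : ℤ, 0 ≤ r → r < a → (G (i * a + r) ↔ G (-(i + 1) * a + r + b))) (z : ℤ) :
    G z ↔ G 0 := by
  have h1 : ∀ (k : ℕ) (i : ℤ),
      G (i * a) ↔ G (((-1) ^ k * i + orbitBlock a b k) * a + (k * b % a : ℕ)) := by
    intro k i
    induction k with
    | zero => simp [orbitBlock]
    | succ k ih =>
      have h2 : ((k + 1) * b % a) + a * ((k * b % a + b) / a) = k * b % a + b := by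
        rw [show (k + 1) * b % a = (k * b % a + b) % a by rw [Nat.mod_add_mod]; ring_nf,
          Nat.mod_add_div]
      have h3 : (((k + 1) * b % a : ℕ) : ℤ) + a * ((k * b % a + b) / a : ℕ) =
        (k * b % a : ℕ) + b := by exact_mod_cast h2
      rw [ih, hG _ _ (by positivity) (by exact_mod_cast Nat.mod_lt _ ha0), orbitBlock,
        iff_iff_eq]
      congr 1
      linear_combination -h3
  have h2 : ∀ i : ℤ, G (i * a) ↔ G 0 := by
    -- After `a` steps the remainder is again 0, the sign is +1 and the block index has grown by
    -- `orbitBlock a b a = 1`.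
    have h3 : ∀ i : ℤ, G (i * a) ↔ G ((i + 1) * a) := by
      intro i
      rw [h1 a i, ha.neg_one_pow, orbitBlock_self ha ha0 hb h]
      simp
    intro i
    induction i with
    | zero => simp
    | succ i ih => rw [← h3, ih]
    | pred i ih => rw [h3, sub_add_cancel, ih]
  have h4 : (z % a).toNat ∈ (Finset.range a).image (fun j => j * b % a) := by
    rw [(image_mul_mod_range ha0 h).1, Finset.mem_range]
    have := Int.emod_lt_of_pos z (show (0 : ℤ) < a by exact_mod_cast ha0)
    omega
  obtain ⟨k, -, hk⟩ := Finset.mem_image.1 h4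
  -- The starting block is chosen so that the orbit is at `z` after `k` steps.
  have h5 := h1 k ((-1) ^ k * (z / a - orbitBlock a b k))
  rw [h2, ← mul_assoc, ← mul_pow, neg_one_mul, neg_neg, one_pow, one_mul, sub_add_cancel, hk,
    Int.toNat_of_nonneg (Int.emod_nonneg _ (by omega)), mul_comm, Int.mul_ediv_add_emod] at h5
  exact h5.symm

theorem connected_replicate {m a b : ℕ} (hm : 0 < m) (ha : 0 < a) (h : Nat.gcd a b = 1)
    (hmab : m = 1 ∨ (Even a ∧ Odd b) ∨ (Odd a ∧ Even b ∧ m = 2)) :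
    Connected (List.replicate m a ++ [b]) [m * a + b] (m * a + b) := by
  rintro g hg ⟨hbot, -⟩ x hx
  obtain ⟨htop, hlast⟩ := hg.replicate_append
  have hma : 0 < m * a := Nat.mul_pos hm ha
  have hma' : (0 : ℤ) < m * a := by exact_mod_cast hma
  -- Reversing the block `b` and then the whole interval is translation by `-m * a`, so `g` comes
  -- from a predicate of period `m * a`.
  let G : ℤ → Prop := fun z => g (z % (m * a)).toNat
  have hper : ∀ x y, (m * a : ℤ) ∣ x - y → (G x ↔ G y) := by
    intro x y hxy
    simp only [G]
    rw [Int.emod_eq_emod_iff_emod_sub_eq_zero.2 (Int.emod_eq_zero_of_dvd hxy)]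
  have hgG : ∀ x : ℕ, x < m * a + b → (g x ↔ G x) := by
    intro x
    induction x using Nat.strong_induction_on with
    | _ x ih =>
      intro hx
      rcases lt_or_ge x (m * a) with h1 | h1
      · simp only [G]
        rw [Int.emod_eq_of_lt (by positivity) (by exact_mod_cast h1), Int.toNat_natCast]
      · obtain ⟨y, rfl⟩ := Nat.exists_eq_add_of_le h1
        rw [← hlast y (by omega), ← hbot _ (by omega),
          show m * a + b - 1 - (m * a + (b - 1 - y)) = y by omega, ih y (by omega) (by omega)]
        exact hper _ _ ⟨-1, by push_cast; ring⟩
  -- Reversal of an upper block `a` followed by reversal of the whole interval, read modulo `m * a`.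
  have hG : ∀ i r : ℤ, 0 ≤ r → r < a → (G (i * a + r) ↔ G (-(i + 1) * a + r + b)) := by
    intro i r hr0 hra
    obtain ⟨r, rfl⟩ := Int.eq_ofNat_of_zero_le hr0
    obtain ⟨j, hj⟩ := Int.eq_ofNat_of_zero_le (Int.emod_nonneg i (show (m : ℤ) ≠ 0 by omega))
    have hjm : j < m := by
      have := Int.emod_lt_of_pos i (show (0 : ℤ) < m by omega)
      omega
    have hr : r < a := by exact_mod_cast hra
    have hi := Int.mul_ediv_add_emod i m
    rw [hj] at hi
    obtain ⟨l, rfl⟩ : ∃ l, m = j + 1 + l := ⟨m - (j + 1), by omega⟩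
    have e0 : (j + 1 + l) * a = j * a + a + l * a := by ring
    rw [hper (i * a + r) (j * a + r : ℕ) ⟨i / (j + 1 + l : ℕ), by
      push_cast at hi ⊢; linear_combination (-(a : ℤ)) * hi⟩, ← hgG _ (by omega),
      ← htop j hjm r hr, ← hbot _ (by omega),
      show (j + 1 + l) * a + b - 1 - (j * a + (a - 1 - r)) = l * a + b + r by omega,
      hgG _ (by omega)]
    refine hper _ _ ⟨i / (j + 1 + l : ℕ) + 1, ?_⟩
    push_cast at hi ⊢
    linear_combination (-(a : ℤ)) * hi
  have hcop : IsCoprime (a : ℤ) (b : ℤ) := Nat.isCoprime_iff_coprime.2 h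
  have key : ∀ z, G z ↔ G 0 := by
    have ha' : (0 : ℤ) < a := by exact_mod_cast ha
    have hz : ∀ z : ℤ, G z ↔ G (-(z / a + 1) * a + z % a + b) := fun z => by
      rw [← hG _ _ (Int.emod_nonneg _ ha'.ne') (Int.emod_lt_of_pos _ ha'), mul_comm,
        Int.mul_ediv_add_emod]
    rcases hmab with rfl | ⟨ha2, hb2⟩ | ⟨ha2, hb2, rfl⟩
    · refine iff_zero_of_isCoprime hper (t := b) (fun z => (hz z).trans (hper _ _ ?_)) ?_
      · refine ⟨-(2 * (z / a) + 1), ?_⟩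
        linear_combination Int.mul_ediv_add_emod z a
      · simpa using hcop.symm
    · exact iff_zero_of_even_of_odd ha2 ha hb2 h hG
    -- For `m = 2`, the blocks `-(i + 1)` and `i + 1` agree modulo 2, so the move is translation by
    -- `a + b`, which is odd and hence prime to `2 * a`.
    · refine iff_zero_of_isCoprime hper (t := a + b) (fun z => (hz z).trans (hper _ _ ?_)) ?_
      · refine ⟨-(z / a + 1), ?_⟩
        push_cast
        linear_combination Int.mul_ediv_add_emod z a
      · push_cast
        refine IsCoprime.mul_right ?_ ?_
        · obtain ⟨k, hk⟩ : Odd ((a : ℤ) + b) := by exact_mod_cast ha2.add_even hb2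
          exact ⟨1, -k, by rw [hk]; ring⟩
        · simpa [add_comm] using hcop.symm.add_mul_left_left 1
  rw [hgG x hx, hgG 0 (by omega), key]
  rfl

theorem oddParts_replicate_append (m a b : ℕ) :
    oddParts (List.replicate m a ++ [b]) = m * (a % 2) + b % 2 := by
  simp [oddParts]

theorem oddParts_replicate {m a b : ℕ} (h : Nat.gcd a b = 1)
    (hmab : m = 1 ∨ (Even a ∧ Odd b) ∨ (Odd a ∧ Even b ∧ m = 2)) :
    oddParts (List.replicate m a ++ [b]) + oddParts [m * a + b] = 2 := by
  rw [oddParts_replicate_append, oddParts_cons]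
  simp only [oddParts, List.map_nil, List.sum_nil, add_zero]
  rcases hmab with rfl | ⟨ha2, hb2⟩ | ⟨ha2, hb2, rfl⟩
  · have : ¬ (a % 2 = 0 ∧ b % 2 = 0) := fun h0 => by
      have := Nat.dvd_gcd (Nat.dvd_of_mod_eq_zero h0.1) (Nat.dvd_of_mod_eq_zero h0.2)
      omega
    omega
  · rw [Nat.even_iff] at ha2
    rw [Nat.odd_iff] at hb2
    rw [Nat.add_mod, Nat.mul_mod, ha2, hb2]
    simp
  · rw [Nat.odd_iff] at ha2
    rw [Nat.even_iff] at hb2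
    omega

theorem brick_replicate {m a b : ℕ} (hm : 0 < m) (ha : 0 < a) (h : Nat.gcd a b = 1)
    (hmab : m = 1 ∨ (Even a ∧ Odd b) ∨ (Odd a ∧ Even b ∧ m = 2)) :
    Brick (SeaweedRel (List.replicate m a ++ [b]) [m * a + b] (m * a + b)) :=
  brick_of_connected _ _ _ _ le_rfl (by simp) (by simp) (by positivity)
    (connected_replicate hm ha h hmab) (oddParts_replicate h hmab)

/-! ### The index through forms with scalar stabilizer. -/

/-- Some linear form on the matrices has only the scalars as stabilizer in the parabolic subalgebra
attached to `c`. -/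
def HasScalarStabilizer {n : ℕ} (c : Composition n) : Prop :=
  ∃ φ : Matrix (Fin n) (Fin n) ℂ →ₗ[ℂ] ℂ, ∀ x : Matrix (Fin n) (Fin n) ℂ,
    x.BlockTriangular c.index →
    (∀ y : Matrix (Fin n) (Fin n) ℂ, y.BlockTriangular c.index → φ (x * y) = φ (y * x)) →
    ∃ z : ℂ, x = z • (1 : Matrix (Fin n) (Fin n) ℂ)

section Index

variable {n : ℕ} {c : Composition n}

theorem mem_stabilizer_parabolic {f : Module.Dual ℂ (parabolic c)}
    {φ : Matrix (Fin n) (Fin n) ℂ →ₗ[ℂ] ℂ} (hφ : ∀ x : parabolic c, φ x = f x) {x : parabolic c} :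
    x ∈ stabilizer f ↔ ∀ y : Matrix (Fin n) (Fin n) ℂ, y.BlockTriangular c.index →
      φ (x * y) = φ (y * x) := by
  have h : ∀ y : parabolic c, f ⁅x, y⁆ = φ (x * y) - φ (y * x) := fun y => by
    rw [← hφ, LieSubalgebra.coe_bracket, Ring.lie_def, map_sub]
  constructor
  · intro hx y hy
    exact sub_eq_zero.1 ((h ⟨y, hy⟩).symm.trans (hx ⟨y, hy⟩))
  · intro hx y
    rw [h, hx y y.2, sub_self]

theorem one_mem_parabolic : (1 : Matrix (Fin n) (Fin n) ℂ) ∈ parabolic c :=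
  blockTriangular_one

theorem finrank_stabilizer_parabolic_pos (hn : 0 < n) (f : Module.Dual ℂ (parabolic c)) :
    0 < Module.finrank ℂ (stabilizer f) := by
  have : Nonempty (Fin n) := ⟨⟨0, hn⟩⟩
  refine Module.finrank_pos_iff_exists_ne_zero.2 ⟨⟨⟨1, one_mem_parabolic⟩, fun y => ?_⟩, ?_⟩
  · have : ⁅(⟨1, one_mem_parabolic⟩ : parabolic c), y⁆ = 0 := by
      ext1
      rw [LieSubalgebra.coe_bracket, Ring.lie_def]
      simp
    rw [this, map_zero]
  · intro h
    exact one_ne_zero (congrArg Subtype.val (congrArg Subtype.val h))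

theorem index_parabolic_eq_one_iff (hn : 0 < n) :
    index (parabolic c) = 1 ↔ HasScalarStabilizer c := by
  have : Nonempty (Fin n) := ⟨⟨0, hn⟩⟩
  have hne : (Set.range fun f : Module.Dual ℂ (parabolic c) =>
    Module.finrank ℂ (stabilizer f)).Nonempty := Set.range_nonempty _
  constructor
  · intro h
    obtain ⟨f, hf⟩ := Nat.sInf_mem hne
    change Module.finrank ℂ (stabilizer f) = index (parabolic c) at hf
    rw [h] at hf
    obtain ⟨φ, hφ⟩ := LinearMap.exists_extend (p := (parabolic c).toSubmodule) f
    have hφ' : ∀ x : parabolic c, φ x = f x := fun x => LinearMap.congr_fun hφ x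
    have h1 : (⟨1, one_mem_parabolic⟩ : parabolic c) ∈ stabilizer f :=
      (mem_stabilizer_parabolic hφ').2 fun y _ => by rw [one_mul, mul_one]
    refine ⟨φ, fun x hx hxy => ?_⟩
    have h2 : (⟨x, hx⟩ : parabolic c) ∈ stabilizer f := (mem_stabilizer_parabolic hφ').2 hxy
    obtain ⟨z, hz⟩ := (finrank_eq_one_iff_of_nonzero' (⟨_, h1⟩ : stabilizer f) (fun h =>
      one_ne_zero (congrArg Subtype.val (congrArg Subtype.val h)))).1 hf
      ⟨_, h2⟩
    exact ⟨z, (congrArg Subtype.val (congrArg Subtype.val hz)).symm⟩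
  · rintro ⟨φ, hφ⟩
    let f : Module.Dual ℂ (parabolic c) := φ.comp (parabolic c).toSubmodule.subtype
    have hf : ∀ x : parabolic c, φ x = f x := fun _ => rfl
    have h0 : (⟨1, one_mem_parabolic⟩ : parabolic c) ∈ stabilizer f :=
      (mem_stabilizer_parabolic hf).2 fun y _ => by rw [one_mul, mul_one]
    have h1 : Module.finrank ℂ (stabilizer f) ≤ 1 := by
      refine finrank_le_one (⟨_, h0⟩ : stabilizer f) fun x => ?_
      obtain ⟨z, hz⟩ := hφ x.1.1 x.1.2 ((mem_stabilizer_parabolic hf).1 x.2)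
      exact ⟨z, Subtype.ext (Subtype.ext (show z • 1 = x.1.1 from hz.symm))⟩
    have h2 : index (parabolic c) ≤ Module.finrank ℂ (stabilizer f) := Nat.sInf_le ⟨f, rfl⟩
    refine le_antisymm (h2.trans h1) ?_
    obtain ⟨g, hg⟩ := Nat.sInf_mem hne
    exact (finrank_stabilizer_parabolic_pos hn g).trans_eq hg

theorem mem_specialParabolic {x : Matrix (Fin n) (Fin n) ℂ} :
    x ∈ specialParabolic c ↔ x.BlockTriangular c.index ∧ x.trace = 0 := by
  rw [specialParabolic, LieSubalgebra.mem_inf]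
  rfl

theorem sub_trace_mem_specialParabolic (hn : 0 < n) {x : Matrix (Fin n) (Fin n) ℂ}
    (hx : x.BlockTriangular c.index) :
    x - (x.trace / n) • (1 : Matrix (Fin n) (Fin n) ℂ) ∈ specialParabolic c := by
  have hn' : (n : ℂ) ≠ 0 := by exact_mod_cast hn.ne'
  refine mem_specialParabolic.2 ⟨hx.sub ((parabolic c).smul_mem _ one_mem_parabolic), ?_⟩
  rw [trace_sub, trace_smul, trace_one, Fintype.card_fin, smul_eq_mul, div_mul_cancel₀ _ hn',
    sub_self]

theorem isFrobenius_specialParabolic_iff (hn : 0 < n) :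
    IsFrobenius (specialParabolic c) ↔ HasScalarStabilizer c := by
  have hn' : (n : ℂ) ≠ 0 := by exact_mod_cast hn.ne'
  have hne : (Set.range fun f : Module.Dual ℂ (specialParabolic c) =>
    Module.finrank ℂ (stabilizer f)).Nonempty := Set.range_nonempty _
  constructor
  · intro h
    obtain ⟨f, hf⟩ := Nat.sInf_mem hne
    change Module.finrank ℂ (stabilizer f) = index (specialParabolic c) at hf
    rw [h, Submodule.finrank_eq_zero] at hf
    obtain ⟨ψ, hψ⟩ := LinearMap.exists_extend (p := (specialParabolic c).toSubmodule) f
    have hψ' : ∀ x : specialParabolic c, ψ x = f x := fun x => LinearMap.congr_fun hψ x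
    let φ : Matrix (Fin n) (Fin n) ℂ →ₗ[ℂ] ℂ :=
      ψ - (ψ 1 / n) • traceLinearMap (Fin n) ℂ ℂ
    refine ⟨φ, fun x hx hxy => ⟨x.trace / n, ?_⟩⟩
    have h1 : (⟨_, sub_trace_mem_specialParabolic hn hx⟩ : specialParabolic c) ∈ stabilizer f := by
      intro y
      have h2 := hxy y (mem_specialParabolic.1 y.2).1
      simp only [φ, LinearMap.sub_apply, LinearMap.smul_apply, traceLinearMap_apply,
        trace_mul_comm x y.1, sub_left_inj] at h2
      rw [← hψ', LieSubalgebra.coe_bracket, Ring.lie_def, sub_mul, mul_sub, smul_mul_assoc, one_mul,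
        mul_smul_comm, mul_one, sub_sub_sub_cancel_right, map_sub, h2, sub_self]
    rw [hf, Submodule.mem_bot] at h1
    exact sub_eq_zero.1 (congrArg Subtype.val h1)
  · rintro ⟨φ, hφ⟩
    let f : Module.Dual ℂ (specialParabolic c) := φ.comp (specialParabolic c).toSubmodule.subtype
    have h1 : stabilizer f = ⊥ := by
      rw [Submodule.eq_bot_iff]
      intro x hx
      obtain ⟨z, hz⟩ := hφ x (mem_specialParabolic.1 x.2).1 fun y hy => by
        have h2 : φ (x.1 * (y - (y.trace / n) • 1) - (y - (y.trace / n) • 1) * x.1) = 0 :=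
          hx ⟨_, sub_trace_mem_specialParabolic hn hy⟩
        rw [sub_mul, mul_sub, smul_mul_assoc, one_mul, mul_smul_comm, mul_one,
          sub_sub_sub_cancel_right, map_sub] at h2
        exact sub_eq_zero.1 h2
      have h3 := (mem_specialParabolic.1 x.2).2
      rw [hz, trace_smul, trace_one, Fintype.card_fin, smul_eq_mul, mul_eq_zero,
        or_iff_left hn'] at h3
      rw [h3, zero_smul] at hz
      exact Subtype.ext hz
    have h2 : index (specialParabolic c) ≤ Module.finrank ℂ (stabilizer f) := Nat.sInf_le ⟨f, rfl⟩
    rw [h1, finrank_bot] at h2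
    exact Nat.le_zero.1 h2

/-- For the form y ↦ tr(Fy), stability of `x` tested on the matrix unit at `(j, i)` is the equality
of `F * x` and `x * F` at `(i, j)`. -/
theorem Brick.hasScalarStabilizer (h : Brick fun i j : Fin n => c.index i ≤ c.index j) :
    HasScalarStabilizer c := by
  obtain ⟨F, hF⟩ := h
  refine ⟨(traceLinearMap (Fin n) ℂ ℂ).comp (LinearMap.mulLeft ℂ F), fun x hx hxy =>
    hF x (fun i j hij => hx (not_le.1 hij)) fun i j hij => ?_⟩
  have h1 := hxy (single j i 1) (blockTriangular_single hij 1)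
  simp only [LinearMap.comp_apply, LinearMap.mulLeft_apply, traceLinearMap_apply] at h1
  rw [← mul_assoc, ← mul_assoc, trace_mul_comm (F * single j i 1), ← mul_assoc] at h1
  simpa [trace_mul_single] using h1

theorem blockIndex_eq {L : List ℕ} {k x : ℕ} (hk : k < L.length) (h1 : (L.take k).sum ≤ x)
    (h2 : x < (L.take (k + 1)).sum) : blockIndex L x = k := by
  induction L generalizing k x with
  | nil => simp at hk
  | cons c C ih =>
    rcases k with - | k
    · simp only [List.take_succ_cons, List.take_zero, List.sum_cons, List.sum_nil] at h2
      exact blockIndex_cons_of_lt _ (by omega)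
    · simp only [List.take_succ_cons, List.sum_cons, List.length_cons] at h1 h2 hk
      obtain ⟨y, rfl⟩ := Nat.exists_eq_add_of_le (show c ≤ x by omega)
      rw [blockIndex_cons_add, @ih k y (by omega) (by omega) (by omega)]

theorem blockIndex_blocks (i : Fin n) : blockIndex c.blocks i = c.index i :=
  blockIndex_eq (c.index i).2 (c.sizeUpTo_index_le i) (c.lt_sizeUpTo_index_succ i)

end Index

theorem hasScalarStabilizer_repeatComposition {m a b : ℕ} (hm : 0 < m) (ha : 0 < a) (hb : 0 < b)
    (h : Nat.gcd a b = 1) (hmab : m = 1 ∨ (Even a ∧ Odd b) ∨ (Odd a ∧ Even b ∧ m = 2)) :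
    HasScalarStabilizer (repeatComposition m a b ha hb) := by
  refine ((brick_replicate hm ha h hmab).congr (Equiv.refl _) fun i j => ?_).hasScalarStabilizer
  rw [Equiv.refl_apply, Equiv.refl_apply, SeaweedRel, blockIndex_cons_of_lt _ i.2,
    blockIndex_cons_of_lt _ j.2, and_iff_left le_rfl, Fin.le_def, ← blockIndex_blocks,
    ← blockIndex_blocks]
  rfl

/-! ### The principal element of a form with scalar stabilizer. -/

/-- If the stabilizer of `φ` consists of the scalars, then `φ` is the coadjoint translate of itself
under some `h`. -/
theorem exists_apply_commutator_eq {S : Type*} [Ring S] [Algebra ℂ S] [FiniteDimensional ℂ S]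
    [Nontrivial S] {φ : S →ₗ[ℂ] ℂ} (hφ1 : φ 1 = 0)
    (hφ : ∀ x, (∀ y, φ (x * y) = φ (y * x)) → ∃ z : ℂ, x = z • (1 : S)) :
    ∃ h, ∀ y, φ (h * y - y * h) = φ y := by
  let T : S →ₗ[ℂ] Module.Dual ℂ S := (LinearMap.mul ℂ S - (LinearMap.mul ℂ S).flip).compr₂ φ
  have hT : ∀ x y, T x y = φ (x * y - y * x) := fun x y => rfl
  have hker : LinearMap.ker T = ℂ ∙ (1 : S) := by
    ext x
    rw [LinearMap.mem_ker, Submodule.mem_span_singleton]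
    constructor
    · intro hx
      obtain ⟨z, hz⟩ := hφ x fun y => by
        rw [← sub_eq_zero, ← map_sub, ← hT, hx, LinearMap.zero_apply]
      exact ⟨z, hz.symm⟩
    · rintro ⟨z, rfl⟩
      ext y
      rw [hT]
      simp
  -- The range annihilates 1, and since the kernel is a line both sides have codimension 1.
  have hrange : LinearMap.range T = (ℂ ∙ (1 : S)).dualAnnihilator := by
    refine Submodule.eq_of_le_of_finrank_eq ?_ ?_
    · rintro - ⟨x, rfl⟩
      rw [Submodule.mem_dualAnnihilator]
      intro w hw
      obtain ⟨z, rfl⟩ := Submodule.mem_span_singleton.1 hw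
      rw [hT]
      simp
    · have h1 := T.finrank_range_add_finrank_ker
      have h2 := Subspace.finrank_add_finrank_dualAnnihilator_eq (ℂ ∙ (1 : S))
      rw [hker] at h1
      omega
  have hmem : φ ∈ LinearMap.range T := by
    rw [hrange, Submodule.mem_dualAnnihilator]
    intro w hw
    obtain ⟨z, rfl⟩ := Submodule.mem_span_singleton.1 hw
    rw [map_smul, hφ1, smul_zero]
  obtain ⟨h, hh⟩ := hmem
  exact ⟨h, fun y => by rw [← hT, hh]⟩

section Exp

open NormedSpace

variable {S : Type*} [NormedRing S] [NormedAlgebra ℂ S] [FiniteDimensional ℂ S]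

theorem apply_exp_conj {φ : S →ₗ[ℂ] ℂ} {h : S} (hh : ∀ y, φ (h * y - y * h) = φ y) (t : ℂ) (y : S) :
    φ (exp (t • h) * y * exp (t • -h)) = Complex.exp t * φ y := by
  have : CompleteSpace S := FiniteDimensional.complete ℂ S
  -- By `hh`, the derivative of φ(exp(th) y exp(-th)) is that function itself, so `u` is constant.
  let u : ℂ → ℂ := fun t => Complex.exp (-t) * φ (exp (t • h) * y * exp (t • -h))
  have hu : ∀ t, HasDerivAt u 0 t := by
    intro t
    have h1 : HasDerivAt (fun t : ℂ => exp (t • h) * y * exp (t • -h))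
        (h * exp (t • h) * y * exp (t • -h) + exp (t • h) * y * (exp (t • -h) * -h)) t :=
      ((hasDerivAt_exp_smul_const' h t).mul_const y).mul (hasDerivAt_exp_smul_const (-h) t)
    have h2 := (LinearMap.toContinuousLinearMap φ).hasFDerivAt.comp_hasDerivAt t h1
    have h3 := ((Complex.hasDerivAt_exp (-t)).comp t (hasDerivAt_neg t)).mul h2
    refine h3.congr_deriv ?_
    have h4 := hh (exp (t • h) * y * exp (t • -h))
    have h5 : h * exp (t • h) * y * exp (t • -h) + exp (t • h) * y * (exp (t • -h) * -h) =
        h * (exp (t • h) * y * exp (t • -h)) - exp (t • h) * y * exp (t • -h) * h := by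
      noncomm_ring
    rw [h5, LinearMap.coe_toContinuousLinearMap', h4]
    simp
  have hconst := is_const_of_deriv_eq_zero (fun t => (hu t).differentiableAt)
    (fun t => (hu t).deriv) t 0
  simp only [u, neg_zero, Complex.exp_zero, zero_smul, exp_zero, one_mul, mul_one] at hconst
  rw [← hconst, ← mul_assoc, ← Complex.exp_add, add_neg_cancel, Complex.exp_zero, one_mul]

/-- The element `h` can be normalized to have integral spectrum; then `ε = exp (π i h)` is an
involution whose conjugation negates `φ`. -/
theorem exists_int_spectrum [Nontrivial S] {φ : S →ₗ[ℂ] ℂ} (hφ1 : φ 1 = 0)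
    (hφ : ∀ x, (∀ y, φ (x * y) = φ (y * x)) → ∃ z : ℂ, x = z • (1 : S)) :
    ∃ h : S, (∀ y, φ (h * y - y * h) = φ y) ∧ (∀ r ∈ spectrum ℂ h, ∃ k : ℤ, r = k) ∧
      ∃ ε : S, ε * ε = 1 ∧ ∀ y, φ (ε * y * ε) = -φ y := by
  have : CompleteSpace S := FiniteDimensional.complete ℂ S
  let +nondep : NormedAlgebra ℚ S := .restrictScalars ℚ ℂ S
  have hinv : ∀ x : S, exp (-x) * exp x = 1 := fun x => by
    rw [← NormedSpace.exp_add_of_commute (Commute.neg_left (Commute.refl x)), neg_add_cancel, exp_zero]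
  have hinv' : ∀ x : S, exp x * exp (-x) = 1 := fun x => by
    simpa using hinv (-x)
  obtain ⟨h₀, hh₀⟩ := exists_apply_commutator_eq hφ1 hφ
  -- At `t = 2πi` the scaling factor is 1, so this exponential stabilizes `φ` and is a scalar.
  obtain ⟨z, hz⟩ := hφ (exp ((2 * Real.pi * Complex.I) • h₀)) fun y => by
    have h1 := apply_exp_conj hh₀ (2 * Real.pi * Complex.I)
      (y * exp ((2 * Real.pi * Complex.I) • h₀))
    rw [mul_assoc, mul_assoc y, smul_neg, hinv', mul_one, Complex.exp_two_pi_mul_I, one_mul] at h1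
    exact h1
  have hz0 : z ≠ 0 := by
    rintro rfl
    have := hinv ((2 * Real.pi * Complex.I) • h₀)
    rw [hz, zero_smul, mul_zero] at this
    exact zero_ne_one this
  have hpi : 2 * Real.pi * Complex.I ≠ 0 := Complex.two_pi_I_ne_zero
  let h : S := h₀ - (Complex.log z / (2 * Real.pi * Complex.I)) • (1 : S)
  have hh : ∀ y, φ (h * y - y * h) = φ y := fun y => by
    have : h * y - y * h = h₀ * y - y * h₀ := by
      simp only [h, sub_mul, mul_sub, smul_mul_assoc, mul_smul_comm, one_mul, mul_one]
      abel
    rw [this, hh₀]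
  have hexp : exp ((2 * Real.pi * Complex.I) • h) = 1 := by
    have h1 : (2 * Real.pi * Complex.I) • h =
        (2 * Real.pi * Complex.I) • h₀ + algebraMap ℂ S (-Complex.log z) := by
      rw [smul_sub, smul_smul, mul_div_cancel₀ _ hpi, Algebra.algebraMap_eq_smul_one, neg_smul,
        sub_eq_add_neg]
    rw [h1, NormedSpace.exp_add_of_commute (Algebra.commutes _ _).symm, ← algebraMap_exp_comm, hz,
      ← Complex.exp_eq_exp_ℂ, Complex.exp_neg, Complex.exp_log hz0,
      Algebra.algebraMap_eq_smul_one, smul_mul_smul_comm, mul_inv_cancel₀ hz0, one_smul, one_mul]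
  have hεε : exp ((Real.pi * Complex.I) • h) * exp ((Real.pi * Complex.I) • h) = 1 := by
    rw [← NormedSpace.exp_add_of_commute (Commute.refl _), ← add_smul, ← two_mul, ← mul_assoc, hexp]
  have hspec : ∀ r ∈ spectrum ℂ h, ∃ k : ℤ, r = k := by
    intro r hr
    have h1 := spectrum.exp_mem_exp _ ((spectrum.smul_mem_smul_iff
      (r := Units.mk0 _ Complex.two_pi_I_ne_zero)).2 hr)
    rw [Units.smul_mk0, Units.smul_mk0, hexp, spectrum.one_eq, Set.mem_singleton_iff,
      ← Complex.exp_eq_exp_ℂ, smul_eq_mul, Complex.exp_eq_one_iff] at h1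
    obtain ⟨k, hk⟩ := h1
    exact ⟨k, mul_left_cancel₀ Complex.two_pi_I_ne_zero (hk.trans (mul_comm _ _))⟩
  refine ⟨h, hh, hspec, exp ((Real.pi * Complex.I) • h), hεε, fun y => ?_⟩
  have h1 := apply_exp_conj hh (Real.pi * Complex.I) y
  have h2 : exp ((Real.pi * Complex.I) • -h) = exp ((Real.pi * Complex.I) • h) := by
    rw [smul_neg, ← mul_one (exp (-_)), ← hεε, ← mul_assoc, hinv, one_mul]
  rw [h2, Complex.exp_pi_mul_I, neg_one_mul] at h1
  exact h1

end Exp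

/-! ### Trace identities from a nondegenerate form. -/

/-- Through `B`, the map `f` becomes the transpose of `g`. -/
theorem trace_eq_of_adjoint {V : Type*} [AddCommGroup V] [Module ℂ V] [FiniteDimensional ℂ V]
    {B : V →ₗ[ℂ] Module.Dual ℂ V} (hB : Function.Injective B) {f g : V →ₗ[ℂ] V}
    (hfg : ∀ x y, B (f x) y = B x (g y)) : LinearMap.trace ℂ V f = LinearMap.trace ℂ V g := by
  let e : V ≃ₗ[ℂ] Module.Dual ℂ V := LinearEquiv.ofBijective B
    ⟨hB, (LinearMap.injective_iff_surjective_of_finrank_eq_finrank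
      (Subspace.dual_finrank_eq (K := ℂ) (V := V)).symm).1 hB⟩
  have h : e.conj f = Module.Dual.transpose (R := ℂ) g := by
    refine LinearMap.ext fun l => ?_
    obtain ⟨x, rfl⟩ := e.surjective l
    refine LinearMap.ext fun y => ?_
    rw [LinearEquiv.conj_apply_apply, LinearEquiv.symm_apply_apply]
    exact hfg x y
  rw [← LinearMap.trace_conj' f e, h, LinearMap.trace_transpose']

/-- The commutator form degenerates only along the scalars, where the rank-one term `τ ⊗ τ` is
nonzero. -/
theorem injective_commutator_add_trace {S : Type*} [Ring S] [Algebra ℂ S] {φ τ : S →ₗ[ℂ] ℂ}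
    (hφ : ∀ x, (∀ y, φ (x * y) = φ (y * x)) → ∃ z : ℂ, x = z • (1 : S)) (hτ1 : τ 1 ≠ 0) :
    Function.Injective ((LinearMap.mul ℂ S - (LinearMap.mul ℂ S).flip).compr₂ φ + τ.smulRight τ) := by
  rw [injective_iff_map_eq_zero]
  intro x hx
  have h1 : ∀ y, φ (x * y - y * x) + τ x * τ y = 0 := fun y => LinearMap.congr_fun hx y
  have h2 : τ x = 0 := by
    have := h1 1
    rw [mul_one, one_mul, sub_self, map_zero, zero_add] at this
    exact (mul_eq_zero.1 this).resolve_right hτ1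
  obtain ⟨z, rfl⟩ := hφ x fun y => by
    have := h1 y
    rwa [h2, zero_mul, add_zero, map_sub, sub_eq_zero] at this
  rw [map_smul, smul_eq_mul, mul_eq_zero, or_iff_left hτ1] at h2
  rw [h2, zero_smul]

section Trace

variable {S : Type*} [Ring S] [Algebra ℂ S] [FiniteDimensional ℂ S]

/-- The relation φ([h, y]) = φ(y) makes the adjoint of ad h equal to id - ad h minus the projection
onto the scalars, which has trace 1. -/
theorem trace_commutator_eq {φ τ : S →ₗ[ℂ] ℂ}
    (hφ : ∀ x, (∀ y, φ (x * y) = φ (y * x)) → ∃ z : ℂ, x = z • (1 : S))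
    (hτ : ∀ x y, τ (x * y) = τ (y * x)) (hτ1 : τ 1 ≠ 0) {h : S}
    (hh : ∀ y, φ (h * y - y * h) = φ y) :
    2 * LinearMap.trace ℂ S (LinearMap.mulLeft ℂ h - LinearMap.mulRight ℂ h) =
      Module.finrank ℂ S - 1 := by
  have h1 := trace_eq_of_adjoint (injective_commutator_add_trace hφ hτ1)
    (f := LinearMap.mulLeft ℂ h - LinearMap.mulRight ℂ h)
    (g := LinearMap.id - (LinearMap.mulLeft ℂ h - LinearMap.mulRight ℂ h) -
      (τ 1)⁻¹ • τ.smulRight (1 : S)) fun x y => by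
    have e1 := hh (x * y - y * x)
    have e2 : h * (x * y - y * x) - (x * y - y * x) * h =
      ((h * x - x * h) * y - y * (h * x - x * h)) + (x * (h * y - y * h) - (h * y - y * h) * x) := by
      noncomm_ring
    rw [e2, map_add] at e1
    have e3 : τ (h * x - x * h) = 0 := by rw [map_sub, hτ, sub_self]
    have e4 : τ (h * y - y * h) = 0 := by rw [map_sub, hτ, sub_self]
    change φ ((h * x - x * h) * y - y * (h * x - x * h)) + τ (h * x - x * h) * τ y =
      φ (x * (y - (h * y - y * h) - (τ 1)⁻¹ • τ y • (1 : S)) -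
        (y - (h * y - y * h) - (τ 1)⁻¹ • τ y • (1 : S)) * x) +
        τ x * τ (y - (h * y - y * h) - (τ 1)⁻¹ • τ y • (1 : S))
    have e5 : x * (y - (h * y - y * h) - (τ 1)⁻¹ • τ y • (1 : S)) -
        (y - (h * y - y * h) - (τ 1)⁻¹ • τ y • (1 : S)) * x =
        (x * y - y * x) - (x * (h * y - y * h) - (h * y - y * h) * x) := by
      simp only [mul_sub, sub_mul, mul_smul_comm, smul_mul_assoc, mul_one, one_mul]
      abel
    have e6 : τ (y - (h * y - y * h) - (τ 1)⁻¹ • τ y • (1 : S)) = 0 := by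
      rw [map_sub, map_sub, e4, map_smul, map_smul, smul_eq_mul, smul_eq_mul]
      field_simp
      ring
    rw [e3, e5, e6, map_sub φ (x * y - y * x), ← e1]
    ring
  rw [map_sub (LinearMap.trace ℂ S) (LinearMap.id - _), map_sub (LinearMap.trace ℂ S) LinearMap.id,
    LinearMap.trace_id, map_smul, LinearMap.trace_smulRight, smul_eq_mul, inv_mul_cancel₀ hτ1] at h1
  linear_combination h1

/-- Conjugation by `ε` reverses the commutator form and preserves `τ`, so its adjoint is twice the
projection onto the scalars minus itself; the trace t satisfies t = 2 - t. -/
theorem trace_conj_eq_one {φ τ : S →ₗ[ℂ] ℂ}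
    (hφ : ∀ x, (∀ y, φ (x * y) = φ (y * x)) → ∃ z : ℂ, x = z • (1 : S))
    (hτ : ∀ x y, τ (x * y) = τ (y * x)) (hτ1 : τ 1 ≠ 0) {ε : S} (hε : ε * ε = 1)
    (hφε : ∀ y, φ (ε * y * ε) = -φ y) :
    LinearMap.trace ℂ S (LinearMap.mulLeft ℂ ε ∘ₗ LinearMap.mulRight ℂ ε) = 1 := by
  have h1 := trace_eq_of_adjoint (injective_commutator_add_trace hφ hτ1)
    (f := LinearMap.mulLeft ℂ ε ∘ₗ LinearMap.mulRight ℂ ε)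
    (g := (2 * (τ 1)⁻¹) • τ.smulRight (1 : S) -
      LinearMap.mulLeft ℂ ε ∘ₗ LinearMap.mulRight ℂ ε) fun x y => by
    have e0 : ∀ w, ε * (ε * w) = w := fun w => by rw [← mul_assoc, hε, one_mul]
    have e1 := hφε (x * (ε * (y * ε)) - ε * (y * ε) * x)
    have e2 : ε * (x * (ε * (y * ε)) - ε * (y * ε) * x) * ε =
        ε * (x * ε) * y - y * (ε * (x * ε)) := by
      simp only [mul_sub, sub_mul, mul_assoc, hε, e0, mul_one]
    have e3 : ∀ w, τ (ε * (w * ε)) = τ w := fun w => by rw [hτ, mul_assoc, hε, mul_one]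
    rw [e2] at e1
    change φ (ε * (x * ε) * y - y * (ε * (x * ε))) + τ (ε * (x * ε)) * τ y =
      φ (x * ((2 * (τ 1)⁻¹) • τ y • (1 : S) - ε * (y * ε)) -
        ((2 * (τ 1)⁻¹) • τ y • (1 : S) - ε * (y * ε)) * x) +
        τ x * τ ((2 * (τ 1)⁻¹) • τ y • (1 : S) - ε * (y * ε))
    have e5 : x * ((2 * (τ 1)⁻¹) • τ y • (1 : S) - ε * (y * ε)) -
        ((2 * (τ 1)⁻¹) • τ y • (1 : S) - ε * (y * ε)) * x =
        -(x * (ε * (y * ε)) - ε * (y * ε) * x) := by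
      simp only [mul_sub, sub_mul, mul_smul_comm, smul_mul_assoc, mul_one, one_mul]
      abel
    have e6 : τ ((2 * (τ 1)⁻¹) • τ y • (1 : S) - ε * (y * ε)) = τ y := by
      rw [map_sub, e3, map_smul, map_smul, smul_eq_mul, smul_eq_mul]
      field_simp
      ring
    rw [e1, e3, e5, e6, map_neg]
  rw [map_sub, map_smul, LinearMap.trace_smulRight, smul_eq_mul, mul_assoc,
    inv_mul_cancel₀ hτ1] at h1
  linear_combination h1 / 2

end Trace

/-! ### Traces on block triangular matrices. -/

section BlockSum

variable {ι α R : Type*} [Fintype ι] [Fintype α] [LinearOrder α] [CommRing R]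

theorem sum_sum_ite_le_fiberwise (b : ι → α) (u v : ι → R) :
    (∑ i, ∑ j, if b i ≤ b j then u i * v j else 0) =
      ∑ k, ∑ l, if k ≤ l then (∑ i with b i = k, u i) * (∑ j with b j = l, v j) else 0 := by
  have h1 : ∀ k, (∑ j, if k ≤ b j then v j else 0) =
      ∑ l, if k ≤ l then (∑ j with b j = l, v j) else 0 := by
    intro k
    rw [← Finset.sum_fiberwise (s := Finset.univ) (g := b)]
    refine Finset.sum_congr rfl fun l _ => ?_
    split_ifs with h
    · exact Finset.sum_congr rfl fun j hj => if_pos (by rwa [(Finset.mem_filter.1 hj).2])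
    · exact Finset.sum_eq_zero fun j hj => if_neg (by rwa [(Finset.mem_filter.1 hj).2])
  have h2 : ∀ (x : R) (p : Prop) [Decidable p] (y : R), (if p then x * y else 0) =
      x * if p then y else 0 := fun x p _ y => by rw [mul_ite, mul_zero]
  simp only [h2, ← Finset.mul_sum]
  rw [← Finset.sum_fiberwise (s := Finset.univ) (g := b)]
  refine Finset.sum_congr rfl fun k _ => ?_
  rw [← h1, Finset.sum_mul]
  exact Finset.sum_congr rfl fun i hi => by rw [(Finset.mem_filter.1 hi).2]

theorem sum_sq_add_sq_sum (e : α → R) :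
    ∑ k, e k ^ 2 + (∑ k, e k) ^ 2 = 2 * ∑ k, ∑ l, if k ≤ l then e k * e l else 0 := by
  have h1 : (∑ k, ∑ l, if k ≤ l then e k * e l else 0) =
      ∑ k, ∑ l, if l ≤ k then e k * e l else 0 := by
    rw [Finset.sum_comm]
    simp only [mul_comm]
  have h2 : ∑ k, e k ^ 2 = ∑ k, ∑ l, if k = l then e k * e l else 0 := by
    simp [sq]
  rw [two_mul]
  nth_rw 2 [h1]
  rw [h2, sq, Finset.sum_mul_sum, ← Finset.sum_add_distrib, ← Finset.sum_add_distrib]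
  refine Finset.sum_congr rfl fun k _ => ?_
  rw [← Finset.sum_add_distrib, ← Finset.sum_add_distrib]
  refine Finset.sum_congr rfl fun l _ => ?_
  rcases lt_trichotomy k l with h | h | h
  · simp [h.ne, h.le, h.not_ge]
  · simp [h]
  · simp [h.ne', h.le, h.not_ge]

end BlockSum

theorem exists_trace_eq_of_mul_self_eq_one {ι : Type*} [Fintype ι] [DecidableEq ι]
    {M : Matrix ι ι ℂ} (hM : M * M = 1) :
    ∃ r : ℕ, M.trace = ((2 * (r : ℤ) - Fintype.card ι : ℤ) : ℂ) := by
  -- The projection onto the eigenvalue 1; its rank is the integer `r`.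
  let P : Matrix ι ι ℂ := (2⁻¹ : ℂ) • (M + 1)
  have hP : IsIdempotentElem P := by
    change P * P = P
    simp only [P, smul_mul_smul_comm, add_mul, mul_add, hM, mul_one, one_mul]
    rw [show 1 + M + (M + 1) = (2 : ℂ) • (M + 1) by rw [two_smul]; abel, smul_smul]
    norm_num
  have hP' : IsIdempotentElem (toLin' P) := by
    change toLin' P * toLin' P = toLin' P
    rw [Module.End.mul_eq_comp, ← toLin'_mul, hP.eq]
  refine ⟨Module.finrank ℂ (LinearMap.range (toLin' P)), ?_⟩
  have h1 := (LinearMap.IsIdempotentElem.isProj_range _ hP').trace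
  rw [trace_toLin'_eq] at h1
  push_cast
  rw [← h1]
  simp only [P, trace_smul, trace_add, trace_one, smul_eq_mul]
  ring

theorem exists_int_trace_of_roots {ι : Type*} [Fintype ι] [DecidableEq ι] {M : Matrix ι ι ℂ}
    (hM : ∀ r, M.charpoly.IsRoot r → ∃ k : ℤ, r = k) : ∃ k : ℤ, M.trace = k := by
  have h1 : M.charpoly.roots.sum ∈ (Int.castAddHom ℂ).range :=
    multiset_sum_mem _ fun r hr => by
      obtain ⟨k, rfl⟩ := hM r (Polynomial.isRoot_of_mem_roots hr)
      exact ⟨k, rfl⟩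
  obtain ⟨k, hk⟩ := h1
  exact ⟨k, by rw [trace_eq_sum_roots_charpoly, ← hk]; rfl⟩

theorem trace_toSquareBlock {ι α : Type*} [Fintype ι] [DecidableEq α] (b : ι → α)
    (M : Matrix ι ι ℂ) (k : α) : (M.toSquareBlock b k).trace = ∑ i with b i = k, M i i := by
  rw [Finset.sum_subtype (p := fun i => b i = k) _ (fun i => by simp)]
  rfl

section BlockTriangular

variable {ι α : Type*} [Fintype ι] [DecidableEq ι] [LinearOrder α] {b : ι → α}

theorem toSquareBlock_mul_self {M : Matrix ι ι ℂ} (hM : M.BlockTriangular b) (h : M * M = 1)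
    (k : α) : M.toSquareBlock b k * M.toSquareBlock b k = 1 := by
  ext ⟨i, hi⟩ ⟨j, hj⟩
  have h1 := congrFun (congrFun h i) j
  rw [Matrix.mul_apply] at h1 ⊢
  have h2 : ∑ x, M i x * M x j = ∑ x with b x = k, M i x * M x j := by
    refine (Finset.sum_filter_of_ne fun x _ hx => ?_).symm
    by_contra hne
    rcases lt_or_gt_of_ne hne with h3 | h3
    · exact hx (by rw [hM (h3.trans_eq hi.symm), zero_mul])
    · exact hx (by rw [hM (hj.trans_lt h3), mul_zero])
  rw [h2, Finset.sum_subtype (p := fun i => b i = k) _ (fun i => by simp)] at h1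
  refine h1.trans ?_
  simp [Matrix.one_apply]

theorem isRoot_charpoly_of_toSquareBlock {M : Matrix ι ι ℂ} (hM : M.BlockTriangular b) {k : α}
    {r : ℂ} (hr : (M.toSquareBlock b k).charpoly.IsRoot r) : M.charpoly.IsRoot r := by
  by_cases hk : k ∈ Finset.univ.image b
  · rw [hM.charpoly]
    exact hr.dvd (Finset.dvd_prod_of_mem _ hk)
  · have : IsEmpty {i // b i = k} :=
      ⟨fun i => hk (Finset.mem_image.2 ⟨i, Finset.mem_univ _, i.2⟩)⟩
    simp [Matrix.charpoly, Polynomial.IsRoot] at hr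

theorem trace_mulLeft_comp_mulRight (u v : blockTriangularSubalgebra ℂ ℂ b) :
    LinearMap.trace ℂ (blockTriangularSubalgebra ℂ ℂ b)
      (LinearMap.mulLeft ℂ u ∘ₗ LinearMap.mulRight ℂ v) =
      ∑ i, ∑ j, if b i ≤ b j then u.1 i i * v.1 j j else 0 := by
  -- Cutting off the other positions extends the operator to all matrices with image in the
  -- subalgebra. The trace is unchanged and is read off on matrix units.
  let mask : Matrix ι ι ℂ →ₗ[ℂ] Matrix ι ι ℂ :=
    { toFun := fun M => Matrix.of fun i j => if b i ≤ b j then M i j else 0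
      map_add' := fun M N => by ext i j; simp only [of_apply, Matrix.add_apply]; split_ifs <;> simp
      map_smul' := fun z M => by ext i j; simp }
  let f : Matrix ι ι ℂ →ₗ[ℂ] Matrix ι ι ℂ :=
    mask ∘ₗ LinearMap.mulLeft ℂ u.1 ∘ₗ LinearMap.mulRight ℂ v.1
  have hf : ∀ M, f M ∈ Subalgebra.toSubmodule (blockTriangularSubalgebra ℂ ℂ b) := fun M i j hij =>
    if_neg (not_le.2 hij)
  have h1 := LinearMap.trace_restrict_eq_of_forall_mem _ f hf
  have h2 : (f.restrict (p := Subalgebra.toSubmodule (blockTriangularSubalgebra ℂ ℂ b))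
      (q := Subalgebra.toSubmodule (blockTriangularSubalgebra ℂ ℂ b)) fun x _ => hf x) =
      (LinearMap.mulLeft ℂ u ∘ₗ LinearMap.mulRight ℂ v :
        blockTriangularSubalgebra ℂ ℂ b →ₗ[ℂ] blockTriangularSubalgebra ℂ ℂ b) := by
    refine LinearMap.ext fun x => Subtype.ext ?_
    ext i j
    change (if b i ≤ b j then (u.1 * (x.1 * v.1)) i j else 0) = (u.1 * (x.1 * v.1)) i j
    split_ifs with h
    · rfl
    · have hx : u.1 * (x.1 * v.1) ∈ blockTriangularSubalgebra ℂ ℂ b := mul_mem u.2 (mul_mem x.2 v.2)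
      exact (hx (not_le.1 h)).symm
  refine (congrArg (LinearMap.trace ℂ _) h2.symm).trans (h1.trans ?_)
  rw [LinearMap.trace_eq_matrix_trace ℂ (Matrix.stdBasis ℂ ι ι), Matrix.trace, Fintype.sum_prod_type]
  refine Finset.sum_congr rfl fun i _ => Finset.sum_congr rfl fun j _ => ?_
  rw [diag_apply, LinearMap.toMatrix_apply, Matrix.stdBasis_eq_single]
  have h3 : ∀ M : Matrix ι ι ℂ, (Matrix.stdBasis ℂ ι ι).repr M (i, j) = M i j := fun M => rfl
  rw [h3]
  change (if b i ≤ b j then (u.1 * (single i j (1 : ℂ) * v.1) : Matrix ι ι ℂ) i j else 0) = _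
  congr 1
  simp [Matrix.mul_apply, Matrix.single_apply, ite_and]

end BlockTriangular

theorem card_filter_index {n : ℕ} (c : Composition n) (k : Fin c.length) :
    (Finset.univ.filter fun i => c.index i = k).card = c.blocksFun k := by
  have h : (Finset.univ.filter fun i => c.index i = k) =
      Finset.univ.map (c.embedding k).toEmbedding := by
    ext i
    simp only [Finset.mem_filter, Finset.mem_univ, true_and, Finset.mem_map]
    rw [eq_comm, ← c.mem_range_embedding_iff']
    rfl
  rw [h, Finset.card_map, Finset.card_univ, Fintype.card_fin]

theorem oddParts_blocks {n : ℕ} (c : Composition n) :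
    oddParts c.blocks = ∑ k, c.blocksFun k % 2 := by
  rw [oddParts, ← c.ofFn_blocksFun, List.map_ofFn, List.sum_ofFn]
  rfl

open scoped Matrix.Norms.Operator in
theorem HasScalarStabilizer.exists_blockTriangular {n : ℕ} {c : Composition n} (hn : 0 < n)
    (hc : HasScalarStabilizer c) :
    ∃ h ε : Matrix (Fin n) (Fin n) ℂ, h.BlockTriangular c.index ∧ ε.BlockTriangular c.index ∧
      ε * ε = 1 ∧ (∀ r, h.charpoly.IsRoot r → ∃ k : ℤ, r = k) ∧
      (∑ i, ∑ j, if c.index i ≤ c.index j then ε i i * ε j j else 0) = 1 ∧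
      2 * ((∑ i, ∑ j, if c.index i ≤ c.index j then h i i * (fun _ => 1) j else 0) -
        ∑ i, ∑ j, if c.index i ≤ c.index j then (fun _ => 1) i * h j j else 0) =
        (∑ i, ∑ j, if c.index i ≤ c.index j then (fun _ => 1) i * (fun _ => 1) j else 0) - 1 := by
  have : Nonempty (Fin n) := ⟨⟨0, hn⟩⟩
  have hn' : (n : ℂ) ≠ 0 := by exact_mod_cast hn.ne'
  obtain ⟨ψ, hψ⟩ := hc
  let S := blockTriangularSubalgebra ℂ ℂ c.index
  let τ : S →ₗ[ℂ] ℂ := (traceLinearMap (Fin n) ℂ ℂ) ∘ₗ S.val.toLinearMap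
  -- A multiple of the trace vanishes on commutators; this one makes `φ 1 = 0`.
  let φ : S →ₗ[ℂ] ℂ := ψ ∘ₗ S.val.toLinearMap - (ψ 1 / n) • τ
  have hτ : ∀ x y, τ (x * y) = τ (y * x) := fun x y => trace_mul_comm x.1 y.1
  have hτ1 : τ 1 = n := by
    change trace (1 : Matrix (Fin n) (Fin n) ℂ) = n
    rw [trace_one, Fintype.card_fin]
  have hφ1 : φ 1 = 0 := by
    change ψ 1 - (ψ 1 / n) * τ 1 = 0
    rw [hτ1, div_mul_cancel₀ _ hn', sub_self]
  have hφ : ∀ x, (∀ y, φ (x * y) = φ (y * x)) → ∃ z : ℂ, x = z • (1 : S) := by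
    intro x hx
    obtain ⟨z, hz⟩ := hψ x.1 x.2 fun y hy => by
      have h1 : ψ (x.1 * y) - (ψ 1 / n) * τ (x * ⟨y, hy⟩) =
        ψ (y * x.1) - (ψ 1 / n) * τ (⟨y, hy⟩ * x) := hx ⟨y, hy⟩
      rwa [hτ, sub_left_inj] at h1
    exact ⟨z, Subtype.ext hz⟩
  obtain ⟨h, hh, hspec, ε, hε, hφε⟩ := exists_int_spectrum hφ1 hφ
  have hτ1' : τ 1 ≠ 0 := by rwa [hτ1]
  refine ⟨h.1, ε.1, h.2, ε.2, congrArg Subtype.val hε, fun r hr => ?_, ?_, ?_⟩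
  · exact hspec r (AlgHom.spectrum_apply_subset S.val h (mem_spectrum_of_isRoot_charpoly hr))
  · rw [← trace_mulLeft_comp_mulRight, trace_conj_eq_one hφ hτ hτ1' hε hφε]
  · have h1 := trace_commutator_eq hφ hτ hτ1' hh
    have h2 := trace_mulLeft_comp_mulRight h 1
    have h3 := trace_mulLeft_comp_mulRight 1 h
    have h4 := trace_mulLeft_comp_mulRight (1 : S) 1
    have h5 : ∀ i, (1 : S).1 i i = 1 := fun i => one_apply_eq i
    simp only [h5] at h2 h3 h4
    rw [LinearMap.mulRight_one, LinearMap.comp_id] at h2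
    rw [LinearMap.mulLeft_one, LinearMap.id_comp] at h3
    rw [LinearMap.mulRight_one, LinearMap.comp_id, LinearMap.mulLeft_one, LinearMap.trace_id] at h4
    rw [map_sub, h2, h3, h4] at h1
    exact h1

/-! ### Arithmetic constraints on the block sizes. -/

theorem HasScalarStabilizer.exists_int {n : ℕ} {c : Composition n} (hn : 0 < n)
    (hc : HasScalarStabilizer c) :
    ∃ H r : Fin c.length → ℤ,
      (∑ k, ∑ l, if k ≤ l then (2 * r k - c.blocksFun k) * (2 * r l - c.blocksFun l) else 0) = 1 ∧
      2 * ((∑ k, ∑ l, if k ≤ l then H k * c.blocksFun l else 0) -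
        ∑ k, ∑ l, if k ≤ l then c.blocksFun k * H l else 0) =
        (∑ k, ∑ l, if k ≤ l then (c.blocksFun k * c.blocksFun l : ℤ) else 0) - 1 := by
  obtain ⟨h, ε, hh, hε, hεε, hroot, h1, h2⟩ := hc.exists_blockTriangular hn
  have hH : ∀ k, ∃ H : ℤ, (∑ i with c.index i = k, h i i) = H := fun k => by
    rw [← trace_toSquareBlock]
    exact exists_int_trace_of_roots fun r hr => hroot r (isRoot_charpoly_of_toSquareBlock hh hr)
  have hr : ∀ k, ∃ r : ℤ, (∑ i with c.index i = k, ε i i) = ((2 * r - c.blocksFun k : ℤ) : ℂ) :=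
    fun k => by
    obtain ⟨r, hr⟩ := exists_trace_eq_of_mul_self_eq_one (toSquareBlock_mul_self hε hεε k)
    rw [← trace_toSquareBlock, hr, Fintype.card_subtype, card_filter_index]
    exact ⟨r, rfl⟩
  choose H hH using hH
  choose r hr using hr
  have hone : ∀ k, (∑ i with c.index i = k, (1 : ℂ)) = c.blocksFun k := fun k => by
    rw [Finset.sum_const, card_filter_index, nsmul_eq_mul, mul_one]
  rw [sum_sum_ite_le_fiberwise c.index (fun i => ε i i) (fun i => ε i i)] at h1
  rw [sum_sum_ite_le_fiberwise c.index (fun i => h i i), sum_sum_ite_le_fiberwise c.index _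
    (fun i => h i i), sum_sum_ite_le_fiberwise c.index] at h2
  simp only [hr] at h1
  simp only [hH, hone] at h2
  exact ⟨H, r, by exact_mod_cast h1, by exact_mod_cast h2⟩

/-- In the identity 2 tr(ad h) = dim S - 1, every term but the last is divisible by `d`, because the
block traces of `h` are integers. -/
theorem HasScalarStabilizer.eq_one_of_forall_dvd {n : ℕ} {c : Composition n} (hn : 0 < n)
    (hc : HasScalarStabilizer c) {d : ℕ} (hd : ∀ k ∈ c.blocks, d ∣ k) : d = 1 := by
  obtain ⟨H, -, -, h⟩ := hc.exists_int hn
  have hd' : ∀ k, (d : ℤ) ∣ c.blocksFun k := fun k =>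
    Int.natCast_dvd_natCast.2 (hd _ (c.blocksFun_mem_blocks k))
  have h1 : (d : ℤ) ∣ ∑ k, ∑ l, if k ≤ l then H k * c.blocksFun l else 0 :=
    Finset.dvd_sum fun k _ => Finset.dvd_sum fun l _ => by
      split_ifs
      exacts [(hd' l).mul_left _, dvd_zero _]
  have h2 : (d : ℤ) ∣ ∑ k, ∑ l, if k ≤ l then c.blocksFun k * H l else 0 :=
    Finset.dvd_sum fun k _ => Finset.dvd_sum fun l _ => by
      split_ifs
      exacts [(hd' k).mul_right _, dvd_zero _]
  have h3 : (d : ℤ) ∣ ∑ k, ∑ l, if k ≤ l then (c.blocksFun k * c.blocksFun l : ℤ) else 0 :=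
    Finset.dvd_sum fun k _ => Finset.dvd_sum fun l _ => by
      split_ifs
      exacts [(hd' k).mul_right _, dvd_zero _]
  have h4 := dvd_sub h3 ((dvd_sub h1 h2).mul_left 2)
  rw [h, sub_sub_cancel] at h4
  exact Nat.dvd_one.1 (by exact_mod_cast h4)

/-- The block traces e of `ε` satisfy ∑ e² + (∑ e)² = 2, and each odd block has an odd, hence
nonzero, trace. -/
theorem HasScalarStabilizer.oddParts_le_two {n : ℕ} {c : Composition n} (hn : 0 < n)
    (hc : HasScalarStabilizer c) : oddParts c.blocks ≤ 2 := by
  obtain ⟨-, r, h, -⟩ := hc.exists_int hn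
  have h1 := sum_sq_add_sq_sum fun k => 2 * r k - c.blocksFun k
  rw [h] at h1
  have h2 : ((oddParts c.blocks : ℕ) : ℤ) ≤ ∑ k, (2 * r k - c.blocksFun k) ^ 2 := by
    rw [oddParts_blocks, Nat.cast_sum]
    refine Finset.sum_le_sum fun k _ => ?_
    rcases Nat.mod_two_eq_zero_or_one (c.blocksFun k) with h3 | h3
    · rw [h3]
      positivity
    · have h4 : 2 * r k - c.blocksFun k ≠ 0 := by omega
      rw [h3]
      have h5 := sq_pos_iff.2 h4
      push_cast
      linarith
  have h3 := sq_nonneg (∑ k, (2 * r k - c.blocksFun k))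
  omega

theorem hasScalarStabilizer_repeatComposition_iff {m a b : ℕ} (hm : 0 < m) (ha : 0 < a)
    (hb : 0 < b) : HasScalarStabilizer (repeatComposition m a b ha hb) ↔
      Nat.gcd a b = 1 ∧ (m = 1 ∨ (Even a ∧ Odd b) ∨ (Odd a ∧ Even b ∧ m = 2)) := by
  refine ⟨fun h => ?_, fun h => hasScalarStabilizer_repeatComposition hm ha hb h.1 h.2⟩
  have hn : 0 < m * a + b := by omega
  have hgcd : Nat.gcd a b = 1 := h.eq_one_of_forall_dvd hn fun k hk => by
    rcases List.mem_append.1 hk with h1 | h1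
    · rw [List.eq_of_mem_replicate h1]
      exact Nat.gcd_dvd_left a b
    · rw [List.mem_singleton.1 h1]
      exact Nat.gcd_dvd_right a b
  refine ⟨hgcd, ?_⟩
  have h1 : oddParts (List.replicate m a ++ [b]) ≤ 2 := h.oddParts_le_two hn
  rw [oddParts_replicate_append] at h1
  rcases Nat.even_or_odd a with ha2 | ha2
  · rcases Nat.even_or_odd b with hb2 | hb2
    · have := Nat.dvd_gcd ha2.two_dvd hb2.two_dvd
      omega
    · exact Or.inr (Or.inl ⟨ha2, hb2⟩)
  · rw [Nat.odd_iff.1 ha2, mul_one] at h1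
    rcases Nat.even_or_odd b with hb2 | hb2
    · by_cases hm1 : m = 1
      · exact Or.inl hm1
      · exact Or.inr (Or.inr ⟨ha2, hb2, by omega⟩)
    · rw [Nat.odd_iff.1 hb2] at h1
      exact Or.inl (by omega)

end BlockParabolic

theorem mainTheorem4 (m a b : ℕ) (hm : 0 < m) (ha : 0 < a) (hb : 0 < b) :
    (BlockParabolic.index
          (BlockParabolic.parabolic (BlockParabolic.repeatComposition m a b ha hb)) = 1 ↔
        Nat.gcd a b = 1 ∧ (m = 1 ∨ (Even a ∧ Odd b) ∨ (Odd a ∧ Even b ∧ m = 2))) ∧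
      (BlockParabolic.IsFrobenius
          (BlockParabolic.specialParabolic (BlockParabolic.repeatComposition m a b ha hb)) ↔
        Nat.gcd a b = 1 ∧ (m = 1 ∨ (Even a ∧ Odd b) ∨ (Odd a ∧ Even b ∧ m = 2))) := by
  have hn : 0 < m * a + b := by omega
  exact ⟨(BlockParabolic.index_parabolic_eq_one_iff hn).trans
      (BlockParabolic.hasScalarStabilizer_repeatComposition_iff hm ha hb),
    (BlockParabolic.isFrobenius_specialParabolic_iff hn).trans
      (BlockParabolic.hasScalarStabilizer_repeatComposition_iff hm ha hb)⟩
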